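/- **Theorem (general prolongation formula).** Let $X=\mathbb R^p$, $U=\mathbb R^q$, let $M\subseteq X\times U$ be open, and let $$v=\sum_{i=1}^p\xi^i(x,u)\,\partial_{x^i}+\sum_{\alpha=1}^q\phi_\alpha(x,u)\,\partial_{u^\alpha}$$ be a smooth vector field on $M$, the infinitesimal generator of a local one-parameter transformation group $\varepsilon\mapsto \mathrm{Fl}^v_\varepsilon$ on $M$ (its flow): a smooth map $(\varepsilon,m)\mapsto \mathrm{Fl}^v_\varepsilon(m)\in M$ on an open set $\mathcal U\subseteq\mathbb R\times M$ containing $\{0\}\times M$, such that $\mathrm{Fl}^v_0=\mathrm{id}$, $\mathrm{Fl}^v_\varepsilon(\mathrm{Fl}^v_\delta(m))=\mathrm{Fl}^v_{\varepsilon+\delta}(m)$ whenever $(\delta,m)$, $(\varepsilon,\mathrm{Fl}^v_\delta(m))$ and $(\varepsilon+\delta,m)$ lie in $\mathcal U$, $(-\varepsilon,\mathrm{Fl}^v_\varepsilon(m))\in\mathcal U$ whenever $(\varepsilon,m)\in\mathcal U$, and $\frac{d}{d\varepsilon}\big|_0\mathrm{Fl}^v_\varepsilon(m)=v(m)$ for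 all $m\in M$. *Notation.* Multi-indices $J=(j_1,\dots,j_k)$, $1\le j_\kappa\le p$, are unordered and $\sharp J=k$; $(J,i)$ is $J$ with $i$ adjoined. The $n$-th jet space $X\times U^{(n)}$ has coordinates $x^i$ and $u^\alpha_J$, $0\le\sharp J\le n$ (with $u^\alpha_0=u^\alpha$); $M^{(n)}$ is the set of its points with $(x,u)\in M$. For a smooth $U$-valued function $f$ of $x$, $\mathrm{pr}^{(n)}f(x)$ is the point with coordinates $u^\alpha_J=\partial_Jf^\alpha(x)$. For a function $P$ of $(x,u^{(n)})$, its total derivative is the function of $(x,u^{(n+1)})$ $$D_iP=\frac{\partial P}{\partial x^i}+\sum_{\alpha}\sum_{0\le\sharp J\le n}u^\alpha_{J,i}\frac{\partial P}{\partial u^\alpha_J},\qquad D_J=D_{j_1}\cdots D_{j_k}.$$ *Prolongation.* For $(x_0,u_0^{(n)})\in M^{(n)}$ and small $\varepsilon$, put $\mathrm{pr}^{(n)}\mathrm{Fl}^v_\varepsilon(x_0,u_0^{(n)})=(\tilde x_0,\mathrm{pr}^{(n)}\tilde f(\tilde x_0))$, where $f$ is any smooth function on a sufficiently small neighbourhood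 of $x_0$ with $\mathrm{pr}^{(n)}f(x_0)=u_0^{(n)}$, $\tilde f$ is the smooth function whose graph is the image under $\mathrm{Fl}^v_\varepsilon$ of the graph of $f$, and $(\tilde x_0,\tilde u_0)=\mathrm{Fl}^v_\varepsilon(x_0,u_0)$. The $n$-th prolongation of $v$ is $\mathrm{pr}^{(n)}v=\frac{d}{d\varepsilon}\big|_0\mathrm{pr}^{(n)}\mathrm{Fl}^v_\varepsilon$. *Claim.* For every $n\ge0$, the prolongation $\mathrm{pr}^{(n)}v$ is well defined and is the smooth vector field on $M^{(n)}$ $$\mathrm{pr}^{(n)}v=v+\sum_{\alpha=1}^q\ \sum_{1\le\sharp J\le n}\phi_\alpha^J(x,u^{(n)})\,\frac{\partial}{\partial u^\alpha_J},$$ with $$\phi^J_\alpha=D_J\Big(\phi_\alpha-\sum_{i=1}^p\xi^iu^\alpha_i\Big)+\sum_{i=1}^p\xi^iu^\alpha_{J,i}.$$ Here the right-hand side, a priori a function on $M^{(\sharp J+1)}$, does not depend on the coordinates of order $\sharp J+1$ nor on the order in which $J$ is listed. -/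

import Mathlib

open scoped ContDiff Topology

/-! ### Multi-indices, jet spaces, partial derivatives

`X = ℝ^p` and `U = ℝ^q` are realized as `Fin p → ℝ` and `Fin q → ℝ`. -/

/-- Unordered multi-indices `J = (j₁, …, j_k)`, `1 ≤ j_l ≤ p`, of order `k ≤ n`. -/
abbrev MultiIndex (p n : ℕ) : Type := {J : Multiset (Fin p) // J.card ≤ n}

instance MultiIndex.instFinite (p n : ℕ) : Finite (MultiIndex p n) := by
  have : Function.Injective
      (fun J : MultiIndex p n => (⟨⟨J.1.card, Nat.lt_succ_of_le J.2⟩, ⟨J.1, rfl⟩⟩ :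
        Σ k : Fin (n + 1), Sym (Fin p) k)) := by
    intro J K h
    apply Subtype.ext
    have h1 := congrArg (fun s : (Σ k : Fin (n + 1), Sym (Fin p) k) => (s.2 : Multiset (Fin p))) h
    exact h1
  exact Finite.of_injective _ this

noncomputable instance MultiIndex.instFintype (p n : ℕ) : Fintype (MultiIndex p n) :=
  Fintype.ofFinite _

/-- The multi-index `(J, i)`. -/
def MultiIndex.snoc {p n : ℕ} (J : MultiIndex p n) (i : Fin p) : MultiIndex p (n + 1) :=
  ⟨i ::ₘ J.1, by rw [Multiset.card_cons]; exact Nat.succ_le_succ J.2⟩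

/-- The space `X × U` of independent and dependent variables. -/
abbrev BaseSpace (p q : ℕ) : Type := (Fin p → ℝ) × (Fin q → ℝ)

/-- The jet space `X × U^(n)`, with coordinates `x^i` and `u^α_J`, `0 ≤ #J ≤ n`. -/
abbrev JetSpace (p q n : ℕ) : Type := (Fin p → ℝ) × (Fin q → MultiIndex p n → ℝ)

namespace JetSpace

variable {p q : ℕ}

/-- The natural projection `X × U^(n) → X × U^(k)`, `k ≤ n`. -/
def proj {n k : ℕ} (h : k ≤ n) (z : JetSpace p q n) : JetSpace p q k :=
  (z.1, fun α J => z.2 α ⟨J.1, J.2.trans h⟩)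

/-- The natural projection `X × U^(n) → X × U`. -/
def base {n : ℕ} (z : JetSpace p q n) : BaseSpace p q :=
  (z.1, fun α => z.2 α ⟨0, Nat.zero_le n⟩)

/-- `M^(n) = M × U_1 × ⋯ × U_n`, for `M ⊆ X × U`. -/
def jetsOver (M : Set (BaseSpace p q)) (n : ℕ) : Set (JetSpace p q n) := {z | z.base ∈ M}

end JetSpace

/-- `∂h/∂x^i`. -/
noncomputable def partialDeriv {p : ℕ} (i : Fin p) (h : (Fin p → ℝ) → ℝ) : (Fin p → ℝ) → ℝ :=
  fun x => fderiv ℝ h x (Pi.single i 1)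

/-- `∂_{j₁} ∂_{j₂} ⋯ ∂_{j_k} h`. -/
noncomputable def iterPartialDeriv {p : ℕ} (L : List (Fin p)) (h : (Fin p → ℝ) → ℝ) :
    (Fin p → ℝ) → ℝ :=
  L.foldr partialDeriv h

/-- The point `(x, pr^(n) f(x))` of the jet space, where `u^α_J = ∂_J f^α(x)`. (For smooth `f` the
order in which the elements of `J` are listed is irrelevant, see `iterPartialDeriv_perm`.) -/
noncomputable def jetAt {p q : ℕ} (n : ℕ) (f : (Fin p → ℝ) → Fin q → ℝ) (x : Fin p → ℝ) :
    JetSpace p q n :=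
  (x, fun α J => iterPartialDeriv J.1.toList (fun y => f y α) x)

/-! ### Total derivatives -/

/-- The total derivative
`D_i P = ∂P/∂x^i + ∑_α ∑_{#J ≤ n} u^α_{J,i} ∂P/∂u^α_J`, a function on the `(n+1)`-st jet space.
See `totalDeriv_jetAt` for its characteristic property. -/
noncomputable def totalDeriv {p q n : ℕ} (i : Fin p) (P : JetSpace p q n → ℝ) :
    JetSpace p q (n + 1) → ℝ := fun w =>
  fderiv ℝ P (w.proj n.le_succ) (Pi.single i 1, 0) +
    ∑ α : Fin q, ∑ J : MultiIndex p n,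
      w.2 α (J.snoc i) * fderiv ℝ P (w.proj n.le_succ) (0, Pi.single α (Pi.single J 1))

/-- `D_J = D_{j₁} D_{j₂} ⋯ D_{j_k}` for `J = (j₁, …, j_k)`. -/
noncomputable def iterTotalDeriv {p q n : ℕ} :
    (L : List (Fin p)) → (JetSpace p q n → ℝ) → (JetSpace p q (n + L.length) → ℝ)
  | [], P => P
  | j :: L, P => totalDeriv j (iterTotalDeriv L P)

section TotalDerivative

variable {p q : ℕ} {Ω : Set (Fin p → ℝ)}

theorem partialDeriv_contDiffOn (hΩ : IsOpen Ω) (i : Fin p) {h : (Fin p → ℝ) → ℝ}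
    (hh : ContDiffOn ℝ ∞ h Ω) : ContDiffOn ℝ ∞ (partialDeriv i h) Ω :=
  (hh.fderiv_of_isOpen hΩ (m := ∞) (by simp)).clm_apply contDiffOn_const

theorem iterPartialDeriv_contDiffOn (hΩ : IsOpen Ω) (L : List (Fin p)) {h : (Fin p → ℝ) → ℝ}
    (hh : ContDiffOn ℝ ∞ h Ω) : ContDiffOn ℝ ∞ (iterPartialDeriv L h) Ω := by
  induction L with
  | nil => exact hh
  | cons j L ih => exact partialDeriv_contDiffOn hΩ j ih

theorem partialDeriv_congr (hΩ : IsOpen Ω) (i : Fin p) {h k : (Fin p → ℝ) → ℝ}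
    (hhk : Set.EqOn h k Ω) : Set.EqOn (partialDeriv i h) (partialDeriv i k) Ω := by
  intro x hx
  have : h =ᶠ[𝓝 x] k := Filter.eventuallyEq_of_mem (hΩ.mem_nhds hx) hhk
  simp only [partialDeriv, this.fderiv_eq]

theorem partialDeriv_comm (hΩ : IsOpen Ω) (i j : Fin p) {h : (Fin p → ℝ) → ℝ}
    (hh : ContDiffOn ℝ ∞ h Ω) :
    Set.EqOn (partialDeriv i (partialDeriv j h)) (partialDeriv j (partialDeriv i h)) Ω := by
  intro x hx
  have hx' : ContDiffAt ℝ ∞ h x := hh.contDiffAt (hΩ.mem_nhds hx)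
  have hs : IsSymmSndFDerivAt ℝ h x := hx'.isSymmSndFDerivAt
    (by rw [minSmoothness_of_isRCLikeNormedField]; exact WithTop.coe_le_coe.2 le_top)
  have hd : DifferentiableAt ℝ (fderiv ℝ h) x :=
    ((hh.fderiv_of_isOpen hΩ (m := ∞) (by simp)).contDiffAt (hΩ.mem_nhds hx)).differentiableAt
      (by simp)
  have key : ∀ a b : Fin p, partialDeriv a (partialDeriv b h) x =
      fderiv ℝ (fderiv ℝ h) x (Pi.single a 1) (Pi.single b 1) := by
    intro a b
    have h1 := (hd.hasFDerivAt.clm_apply (hasFDerivAt_const (Pi.single b (1 : ℝ)) x)).fderiv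
    unfold partialDeriv
    rw [h1]
    simp
  rw [key, key]
  exact hs _ _

theorem iterPartialDeriv_perm (hΩ : IsOpen Ω) {L L' : List (Fin p)} (hL : L.Perm L')
    {h : (Fin p → ℝ) → ℝ} (hh : ContDiffOn ℝ ∞ h Ω) :
    Set.EqOn (iterPartialDeriv L h) (iterPartialDeriv L' h) Ω := by
  induction hL with
  | nil => exact fun _ _ => rfl
  | cons j _ ih => exact partialDeriv_congr hΩ j ih
  | swap j k L => exact partialDeriv_comm hΩ k j (iterPartialDeriv_contDiffOn hΩ L hh)
  | trans _ _ ih₁ ih₂ => exact ih₁.trans ih₂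

/-- The characteristic property of `D_i P`:
`D_i P (x, pr^(n+1) f(x)) = ∂/∂x^i [P (x, pr^(n) f(x))]` for every smooth function `f`. -/
theorem totalDeriv_jetAt {n : ℕ} (hΩ : IsOpen Ω) {f : (Fin p → ℝ) → Fin q → ℝ}
    (hf : ContDiffOn ℝ ∞ f Ω) {x : Fin p → ℝ} (hx : x ∈ Ω) (i : Fin p) {P : JetSpace p q n → ℝ}
    (hP : DifferentiableAt ℝ P (jetAt n f x)) :
    totalDeriv i P (jetAt (n + 1) f x) = partialDeriv i (fun y => P (jetAt n f y)) x := by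
  classical
  have hfα : ∀ α, ContDiffOn ℝ ∞ (fun y => f y α) Ω := fun α => contDiffOn_pi.1 hf α
  have hc : ∀ (α : Fin q) (J : MultiIndex p n), DifferentiableAt ℝ
      (fun y => iterPartialDeriv J.1.toList (fun y => f y α) y) x := fun α J =>
    ((iterPartialDeriv_contDiffOn hΩ J.1.toList (hfα α)).contDiffAt
      (hΩ.mem_nhds hx)).differentiableAt (by simp)
  have h2 : HasFDerivAt (fun y => (jetAt n f y).2)
      (ContinuousLinearMap.pi fun α => ContinuousLinearMap.pi fun J : MultiIndex p n =>
        fderiv ℝ (iterPartialDeriv J.1.toList (fun y => f y α)) x) x :=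
    hasFDerivAt_pi.2 fun α => hasFDerivAt_pi.2 fun J => (hc α J).hasFDerivAt
  have h3 : HasFDerivAt (fun y => jetAt n f y) _ x := (hasFDerivAt_id x).prodMk h2
  have h4 := (hP.hasFDerivAt.comp x h3).fderiv
  have hproj : (jetAt (n + 1) f x).proj n.le_succ = jetAt n f x := rfl
  have hsnoc : ∀ (α : Fin q) (J : MultiIndex p n), (jetAt (n + 1) f x).2 α (J.snoc i) =
      partialDeriv i (iterPartialDeriv J.1.toList (fun y => f y α)) x := by
    intro α J
    refine iterPartialDeriv_perm (L' := i :: J.1.toList) hΩ ?_ (hfα α) hx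
    rw [← Multiset.coe_eq_coe, Multiset.coe_toList, ← Multiset.cons_coe, Multiset.coe_toList]
    rfl
  have hR : partialDeriv i (fun y => P (jetAt n f y)) x = fderiv ℝ P (jetAt n f x)
      (Pi.single i 1, fun α J => (jetAt (n + 1) f x).2 α (J.snoc i)) := by
    simp only [hsnoc]
    exact congrArg (fun T : (Fin p → ℝ) →L[ℝ] ℝ => T (Pi.single i 1)) h4
  rw [hR]
  have hdec : ((Pi.single i 1, fun α J => (jetAt (n + 1) f x).2 α (J.snoc i)) : JetSpace p q n) =
      (Pi.single i 1, 0) + ∑ α : Fin q, ∑ J : MultiIndex p n,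
        (jetAt (n + 1) f x).2 α (J.snoc i) •
          ((0, Pi.single α (Pi.single J 1)) : JetSpace p q n) := by
    refine Prod.ext ?_ ?_
    · simp [Prod.fst_sum]
    · funext β K
      simp [Prod.snd_sum, Finset.sum_apply, Pi.single_apply, Finset.sum_ite_eq]
  rw [hdec, map_add, map_sum]
  simp only [map_sum, map_smul, smul_eq_mul]
  rfl

end TotalDerivative

/-! ### Local one-parameter transformation groups and their prolongations -/

/-- A local one-parameter transformation group (a local transformation group of `(ℝ, +)`) on an
open subset `M` of a normed space: a smooth partial action, defined on an open set
`dom ⊆ ℝ × M` containing `{0} × M`. -/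
structure LocalOneParamGroup {E : Type*} [NormedAddCommGroup E] [NormedSpace ℝ E]
    (M : Set E) where
  /-- the domain of the action -/
  dom : Set (ℝ × E)
  /-- the action (meaningful on `dom` only) -/
  act : ℝ → E → E
  isOpen_dom : IsOpen dom
  mem_of_dom : ∀ ε m, (ε, m) ∈ dom → m ∈ M
  zero_mem_dom : ∀ m ∈ M, ((0 : ℝ), m) ∈ dom
  act_mem : ∀ ε m, (ε, m) ∈ dom → act ε m ∈ M
  contDiffOn_act : ContDiffOn ℝ ∞ (fun y : ℝ × E => act y.1 y.2) dom
  act_act : ∀ ε δ m, (δ, m) ∈ dom → (ε, act δ m) ∈ dom → (ε + δ, m) ∈ dom →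
    act ε (act δ m) = act (ε + δ) m
  act_zero : ∀ m ∈ M, act 0 m = m
  neg_mem_dom : ∀ ε m, (ε, m) ∈ dom → (-ε, act ε m) ∈ dom

namespace LocalOneParamGroup

variable {E : Type*} [NormedAddCommGroup E] [NormedSpace ℝ E] {M : Set E}

/-- The domain of the transformation `act ε`. -/
def domAt (Φ : LocalOneParamGroup M) (ε : ℝ) : Set E := {m | (ε, m) ∈ Φ.dom}

/-- `v` is the infinitesimal generator of `Φ`, so that `Φ` is the flow of `v`. -/
def IsGeneratedBy (Φ : LocalOneParamGroup M) (v : E → E) : Prop :=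
  ∀ m ∈ M, HasDerivAt (fun ε => Φ.act ε m) (v m) 0

end LocalOneParamGroup

/-- `pr^(n) g · z = z'`, for a transformation `g` with domain `D ⊆ X × U`: there are a smooth
function `f` near `x₀`, with graph in `D` and `z = (x₀, pr^(n) f(x₀))`, and a smooth function
`f' = g · f` whose graph is the image under `g` of the graph of `f`, such that
`z' = (x₀', pr^(n) f'(x₀'))`, where `(x₀', u₀') = g · (x₀, u₀)`. -/
def ProlongedMapsTo {p q : ℕ} (n : ℕ) (g : BaseSpace p q → BaseSpace p q)
    (D : Set (BaseSpace p q)) (z z' : JetSpace p q n) : Prop :=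
  ∃ (Ω Ω' : Set (Fin p → ℝ)) (f f' : (Fin p → ℝ) → Fin q → ℝ),
    IsOpen Ω ∧ z.1 ∈ Ω ∧ ContDiffOn ℝ ∞ f Ω ∧ Ω.graphOn f ⊆ D ∧ jetAt n f z.1 = z ∧
    IsOpen Ω' ∧ ContDiffOn ℝ ∞ f' Ω' ∧ g '' Ω.graphOn f = Ω'.graphOn f' ∧
    z' = jetAt n f' (g z.base).1

/-- `V` is the `n`-th prolongation on `M^(n)` of the infinitesimal generator of `Φ`, i.e. the
infinitesimal generator of the prolonged group: for every `z ∈ M^(n)` the point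
`pr^(n) (Φ_ε) · z` is well defined for small `ε`, and its derivative at `ε = 0` is `V z`. -/
def IsProlongation {p q : ℕ} {M : Set (BaseSpace p q)} (Φ : LocalOneParamGroup M) (n : ℕ)
    (V : JetSpace p q n → JetSpace p q n) : Prop :=
  ∀ z ∈ JetSpace.jetsOver M n,
    (∀ᶠ ε in 𝓝 (0 : ℝ), ∃! z' : JetSpace p q n, ProlongedMapsTo n (Φ.act ε) (Φ.domAt ε) z z') ∧
    ∀ c : ℝ → JetSpace p q n,
      (∀ᶠ ε in 𝓝 (0 : ℝ), ProlongedMapsTo n (Φ.act ε) (Φ.domAt ε) z (c ε)) →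
      HasDerivAt c (V z) 0

/-! ### The coefficients in the prolongation formula -/

/-- The vector field `∑ ξ^i ∂/∂x^i + ∑ φ_α ∂/∂u^α` on `X × U`. -/
def vectorField {p q : ℕ} (ξ : Fin p → BaseSpace p q → ℝ) (φ : Fin q → BaseSpace p q → ℝ) :
    BaseSpace p q → BaseSpace p q :=
  fun m => (fun i => ξ i m, fun α => φ α m)

/-- `φ_α - ∑_i ξ^i u^α_i`, a function on the first jet space. -/
def characteristic {p q : ℕ} (ξ : Fin p → BaseSpace p q → ℝ) (φ : Fin q → BaseSpace p q → ℝ)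
    (α : Fin q) : JetSpace p q 1 → ℝ :=
  fun z => φ α z.base - ∑ i, ξ i z.base * z.2 α ⟨{i}, by simp⟩

/-- `D_J (φ_α - ∑_i ξ^i u^α_i) + ∑_i ξ^i u^α_{J,i}` for `J = (j₁, …, j_k)`, as a function on the
`(1+k)`-th jet space. -/
noncomputable def prolongationCoeff {p q : ℕ} (ξ : Fin p → BaseSpace p q → ℝ)
    (φ : Fin q → BaseSpace p q → ℝ) (α : Fin q) (L : List (Fin p)) :
    JetSpace p q (1 + L.length) → ℝ :=
  fun w => iterTotalDeriv L (characteristic ξ φ α) w +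
    ∑ i, ξ i w.base * w.2 α ⟨i ::ₘ (L : Multiset (Fin p)), by simp [add_comm]⟩

/-! Fix `w ∈ M^(n+1)` and let `f` be its Taylor polynomial. For small `ε` the flow carries the graph
of `f` near `x₀` to the graph of `F (ε, ·)`, with `F` jointly smooth: the inverse function theorem
applies to `(ε, x) ↦ (ε, y)`, where `y` is the `X`-component of `Φ_ε (x, f x)`, because its
derivative at `(0, x₀)` is a shear (`exists_openPartialHomeomorph_act_graph`). By the chain rule the
`n`-jet of a transformed function depends only on the `n`-jet of the original
(`EqJet.of_transformed`), so the prolonged action is the curve of jets of `F (ε, ·)`.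

Let `Q = φ_α - ∑ ξ^i u^α_i`. Differentiating `F (ε, y(ε)) = u(ε)` along the orbit of `(x, f x)`
gives `∂_ε F^α (0, x) = Q (jetAt 1 f x)` for all `x` near `x₀` (`fderiv_F_zero`). Along the orbit of
`(x₀, f x₀)`, the derivative of `∂_J F^α` at `ε = 0` is therefore `∂_J (Q ∘ jet of f) + ∑ ξ^i ∂_i
∂_J f^α`, and `∂_J` of a function evaluated on jets is `D_J` (`iterTotalDeriv_jetAt`). This is the
formula (`hasDerivAt_jetAt`).

No computation is needed for the independence claims: the derivative of the curve depends only on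
the projection of `w` to order `n` and on the multiset `J`, whereas `w` and the listing of `J` are
arbitrary (`IsProlongation.coeff_eq`). -/

/-! ### Equality of jets -/

section EqJet

variable {E F G : Type*} [NormedAddCommGroup E] [NormedSpace ℝ E] [NormedAddCommGroup F]
  [NormedSpace ℝ F] [NormedAddCommGroup G] [NormedSpace ℝ G]

/-- `f` and `g` have the same derivatives of order `≤ n` at `x`. -/
def EqJet (n : ℕ) (f g : E → F) (x : E) : Prop :=
  ∀ k ≤ n, iteratedFDeriv ℝ k f x = iteratedFDeriv ℝ k g x

theorem EqJet.apply_eq {n : ℕ} {f g : E → F} {x : E} (h : EqJet n f g x) : f x = g x := by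
  have := congrArg (fun T => T 0) (h 0 (Nat.zero_le n))
  simpa using this

theorem Filter.EventuallyEq.eqJet {f g : E → F} {x : E} (h : f =ᶠ[𝓝 x] g) (n : ℕ) :
    EqJet n f g x := fun k _ => (h.iteratedFDeriv ℝ k).eq_of_nhds

theorem EqJet.refl (n : ℕ) (f : E → F) (x : E) : EqJet n f f x := fun _ _ => rfl

theorem EqJet.trans {n : ℕ} {f g h : E → F} {x : E} (h₁ : EqJet n f g x) (h₂ : EqJet n g h x) :
    EqJet n f h x := fun k hk => (h₁ k hk).trans (h₂ k hk)

theorem EqJet.symm {n : ℕ} {f g : E → F} {x : E} (h : EqJet n f g x) : EqJet n g f x :=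
  fun k hk => (h k hk).symm

/-- Faà di Bruno: the `k`-th derivative of a composite is a sum over ordered partitions of `k`, and
each term involves only derivatives of order at most `k` of the two factors. -/
theorem EqJet.comp {n : ℕ} {g g' : F → G} {f f' : E → F} {x : E} (hgg : EqJet n g g' (f x))
    (hff : EqJet n f f' x) (hg : ContDiffAt ℝ ∞ g (f x)) (hg' : ContDiffAt ℝ ∞ g' (f x))
    (hf : ContDiffAt ℝ ∞ f x) (hf' : ContDiffAt ℝ ∞ f' x) : EqJet n (g ∘ f) (g' ∘ f') x := by
  have hx := hff.apply_eq
  intro k hk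
  have hk' : (k : WithTop ℕ∞) ≤ ∞ := WithTop.coe_le_coe.2 le_top
  rw [iteratedFDeriv_comp hg hf hk', iteratedFDeriv_comp (hx ▸ hg') hf' hk']
  simp only [FormalMultilinearSeries.taylorComp]
  refine Finset.sum_congr rfl fun c _ => ?_
  ext v
  simp only [FormalMultilinearSeries.compAlongOrderedFinpartition_apply, ftaylorSeries,
    ← hx, hgg _ (c.length_le.trans hk)]
  congr 1
  funext m
  simp only [OrderedFinpartition.applyOrderedFinpartition, hff _ ((c.partSize_le m).trans hk)]

theorem EqJet.prodMk {n : ℕ} {f f' : E → F} {g g' : E → G} {x : E} (hff : EqJet n f f' x)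
    (hgg : EqJet n g g' x) (hf : ContDiffAt ℝ ∞ f x) (hf' : ContDiffAt ℝ ∞ f' x)
    (hg : ContDiffAt ℝ ∞ g x) (hg' : ContDiffAt ℝ ∞ g' x) :
    EqJet n (fun y => (f y, g y)) (fun y => (f' y, g' y)) x := by
  intro k hk
  have hk' : (k : WithTop ℕ∞) ≤ ∞ := WithTop.coe_le_coe.2 le_top
  rw [iteratedFDeriv_prodMk hf hg hk', iteratedFDeriv_prodMk hf' hg' hk', hff k hk, hgg k hk]

end EqJet

theorem contDiffAt_iteratedFDeriv {E F : Type*} [NormedAddCommGroup E] [NormedSpace ℝ E]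
    [NormedAddCommGroup F] [NormedSpace ℝ F] {f : E → F} {x : E} (hf : ContDiffAt ℝ ∞ f x) (k : ℕ) :
    ContDiffAt ℝ ∞ (iteratedFDeriv ℝ k f) x :=
  hf.iteratedFDeriv_right (m := ∞) (by exact_mod_cast le_top)

/-! ### Jet coordinates compared with iterated Fréchet derivatives. -/

section Coordinates

variable {p q : ℕ} {Ω : Set (Fin p → ℝ)}

/-- Induction on `L`: the last derivative taken occupies slot `0` of `iteratedFDeriv`, and the head
of the list is likewise the outermost partial derivative. -/
theorem iterPartialDeriv_eq_iteratedFDeriv (hΩ : IsOpen Ω) {h : (Fin p → ℝ) → ℝ}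
    (hh : ContDiffOn ℝ ∞ h Ω) (L : List (Fin p)) :
    Set.EqOn (iterPartialDeriv L h)
      (fun x => iteratedFDeriv ℝ L.length h x fun l => Pi.single (L.get l) 1) Ω := by
  induction L with
  | nil => intro x _; simp [iterPartialDeriv]
  | cons j L ih =>
    intro x hx
    have h1 : iterPartialDeriv (j :: L) h x = partialDeriv j (iterPartialDeriv L h) x := rfl
    rw [h1, partialDeriv_congr hΩ j ih hx, partialDeriv]
    have hd : DifferentiableAt ℝ (iteratedFDeriv ℝ L.length h) x :=
      (contDiffAt_iteratedFDeriv (hh.contDiffAt (hΩ.mem_nhds hx)) _).differentiableAt (by simp)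
    have h2 := (hd.hasFDerivAt.continuousMultilinear_apply_const
      (fun l => Pi.single (L.get l) (1 : ℝ))).fderiv
    rw [h2]
    rfl

theorem eqJet_of_forall_iterPartialDeriv_eq (hΩ : IsOpen Ω) {f g : (Fin p → ℝ) → ℝ}
    (hf : ContDiffOn ℝ ∞ f Ω) (hg : ContDiffOn ℝ ∞ g Ω) {x : Fin p → ℝ} (hx : x ∈ Ω) {n : ℕ}
    (h : ∀ L : List (Fin p), L.length ≤ n → iterPartialDeriv L f x = iterPartialDeriv L g x) :
    EqJet n f g x := by
  intro k hk
  apply ContinuousMultilinearMap.toMultilinearMap_injective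
  refine Module.Basis.ext_multilinear (fun _ => Pi.basisFun ℝ (Fin p)) fun v => ?_
  -- A multilinear map is determined by its values on tuples of basis vectors, and such a tuple is a
  -- list of indices.
  obtain ⟨L, rfl, hL⟩ : ∃ (L : List (Fin p)) (hL : L.length = k), ∀ l, v (Fin.cast hL l) = L.get l :=
    ⟨List.ofFn v, List.length_ofFn, by intro l; simp; rfl⟩
  have := h L hk
  rw [iterPartialDeriv_eq_iteratedFDeriv hΩ hf L hx,
    iterPartialDeriv_eq_iteratedFDeriv hΩ hg L hx] at this
  obtain rfl : v = L.get := funext hL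
  simpa [Pi.basisFun_apply] using this

theorem eqJet_pi {f g : (Fin p → ℝ) → Fin q → ℝ} {x : Fin p → ℝ} (hf : ContDiffAt ℝ ∞ f x)
    (hg : ContDiffAt ℝ ∞ g x) {n : ℕ} :
    EqJet n f g x ↔ ∀ α, EqJet n (fun y => f y α) (fun y => g y α) x := by
  have key : ∀ {f : (Fin p → ℝ) → Fin q → ℝ}, ContDiffAt ℝ ∞ f x → ∀ (k : ℕ) (α : Fin q) v,
      iteratedFDeriv ℝ k (fun y => f y α) x v = iteratedFDeriv ℝ k f x v α := by
    intro f hf k α v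
    have := (ContinuousLinearMap.proj (R := ℝ) (φ := fun _ : Fin q => ℝ) α).iteratedFDeriv_comp_left
      hf (i := k) (WithTop.coe_le_coe.2 le_top)
    exact congrArg (fun T => T v) this
  constructor
  · intro h α k hk
    ext v
    rw [key hf, key hg, h k hk]
  · intro h k hk
    ext v α
    rw [← key hf, ← key hg, h α k hk]

/-- Bridge between the coordinates in which prolongation is defined and the coordinate-free relation
to which the chain rule applies. -/
theorem jetAt_eq_iff_eqJet (hΩ : IsOpen Ω) {f g : (Fin p → ℝ) → Fin q → ℝ}
    (hf : ContDiffOn ℝ ∞ f Ω) (hg : ContDiffOn ℝ ∞ g Ω) {x : Fin p → ℝ} (hx : x ∈ Ω) {n : ℕ} :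
    jetAt n f x = jetAt n g x ↔ EqJet n f g x := by
  have hfα : ∀ α, ContDiffOn ℝ ∞ (fun y => f y α) Ω := fun α => contDiffOn_pi.1 hf α
  have hgα : ∀ α, ContDiffOn ℝ ∞ (fun y => g y α) Ω := fun α => contDiffOn_pi.1 hg α
  rw [eqJet_pi (hf.contDiffAt (hΩ.mem_nhds hx)) (hg.contDiffAt (hΩ.mem_nhds hx))]
  constructor
  · intro h α
    refine eqJet_of_forall_iterPartialDeriv_eq hΩ (hfα α) (hgα α) hx fun L hL => ?_
    have h1 : iterPartialDeriv (L : Multiset (Fin p)).toList (fun y => f y α) x =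
        iterPartialDeriv (L : Multiset (Fin p)).toList (fun y => g y α) x :=
      congrFun (congrFun (congrArg Prod.snd h) α) ⟨(L : Multiset (Fin p)), by simpa using hL⟩
    have hp : (L : Multiset (Fin p)).toList.Perm L := by
      rw [← Multiset.coe_eq_coe, Multiset.coe_toList]
    rwa [iterPartialDeriv_perm hΩ hp (hfα α) hx, iterPartialDeriv_perm hΩ hp (hgα α) hx] at h1
  · intro h
    refine Prod.ext rfl ?_
    funext α J
    change iterPartialDeriv J.1.toList (fun y => f y α) x =
      iterPartialDeriv J.1.toList (fun y => g y α) x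
    rw [iterPartialDeriv_eq_iteratedFDeriv hΩ (hfα α) _ hx,
      iterPartialDeriv_eq_iteratedFDeriv hΩ (hgα α) _ hx]
    simp only
    rw [h α _ (by simpa using J.2)]

end Coordinates

/-! ### The inverse function theorem with a smooth inverse -/

theorem exists_openPartialHomeomorph_contDiffOn_symm {E : Type*} [NormedAddCommGroup E]
    [NormedSpace ℝ E] [CompleteSpace E] {H : E → E} {S : Set E} (hS : IsOpen S)
    (hH : ContDiffOn ℝ ∞ H S) {a : E} (ha : a ∈ S) (A : E ≃L[ℝ] E)
    (hA : HasFDerivAt H (A : E →L[ℝ] E) a) :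
    ∃ e : OpenPartialHomeomorph E E, ⇑e = H ∧ a ∈ e.source ∧ e.source ⊆ S ∧
      ContDiffOn ℝ ∞ e.symm e.target := by
  have hHa : ContDiffAt ℝ ∞ H a := hH.contDiffAt (hS.mem_nhds ha)
  have hfd : ContinuousOn (fderiv ℝ H) S := hH.continuousOn_fderiv_of_isOpen hS (by simp)
  -- Restricting to the points with invertible derivative, an open set, makes the inverse smooth on
  -- the whole target and not only at `H a`.
  set S' : Set E := S ∩ fderiv ℝ H ⁻¹' Set.range ((↑) : (E ≃L[ℝ] E) → E →L[ℝ] E) with hS'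
  have hS'o : IsOpen S' := hfd.isOpen_inter_preimage hS ContinuousLinearEquiv.isOpen
  have haS' : a ∈ S' := ⟨ha, A, hA.fderiv.symm⟩
  set e₀ := hHa.toOpenPartialHomeomorph H hA (by simp)
  refine ⟨e₀.restrOpen S' hS'o, rfl,
    ⟨hHa.mem_toOpenPartialHomeomorph_source hA (by simp), haS'⟩, fun x hx => hx.2.1, ?_⟩
  intro y hy
  have hx := (e₀.restrOpen S' hS'o).map_target hy
  obtain ⟨B, hB⟩ := hx.2.2
  refine ((e₀.restrOpen S' hS'o).contDiffAt_symm (f₀' := B) hy ?_ ?_).contDiffWithinAt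
  · rw [hB]
    exact ((hH.contDiffAt (hS.mem_nhds hx.2.1)).differentiableAt (by simp)).hasFDerivAt
  · exact hH.contDiffAt (hS.mem_nhds hx.2.1)

/-! ### Functions with a prescribed jet -/

section Monomial

variable {p q : ℕ}

/-- The normalized monomial `(x - a)^J / J!`. -/
noncomputable def jetMonomial (a : Fin p → ℝ) (J : Multiset (Fin p)) (x : Fin p → ℝ) : ℝ :=
  ∏ i, (x i - a i) ^ J.count i / ((J.count i).factorial : ℝ)

theorem contDiff_jetMonomial (a : Fin p → ℝ) (J : Multiset (Fin p)) :
    ContDiff ℝ ∞ (jetMonomial a J) := by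
  unfold jetMonomial
  fun_prop

theorem jetMonomial_self (a : Fin p → ℝ) (J : Multiset (Fin p)) :
    jetMonomial a J a = if J = 0 then 1 else 0 := by
  unfold jetMonomial
  split_ifs with h
  · simp [h]
  · obtain ⟨i, hi⟩ := Multiset.exists_mem_of_ne_zero h
    refine Finset.prod_eq_zero (Finset.mem_univ i) ?_
    have : J.count i ≠ 0 := (Multiset.count_pos.2 hi).ne'
    simp [this]

/-- Along the line `x + t e_j` only the `j`-th factor varies; the factorials are chosen so that
differentiating it leaves coefficient `1`. -/
theorem partialDeriv_jetMonomial (a : Fin p → ℝ) (J : Multiset (Fin p)) (j : Fin p) :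
    partialDeriv j (jetMonomial a J) = if j ∈ J then jetMonomial a (J.erase j) else 0 := by
  funext x
  have hd : DifferentiableAt ℝ (jetMonomial a J) x :=
    (contDiff_jetMonomial a J).contDiffAt.differentiableAt (by simp)
  have hline : HasDerivAt (fun t : ℝ => x + t • (Pi.single j (1 : ℝ) : Fin p → ℝ))
      (Pi.single j 1) 0 := by
    simpa using ((hasDerivAt_id (0 : ℝ)).smul_const (Pi.single j (1 : ℝ) : Fin p → ℝ)).const_add x
  have h1 : HasDerivAt (fun t : ℝ => jetMonomial a J (x + t • (Pi.single j (1 : ℝ) : Fin p → ℝ)))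
      (partialDeriv j (jetMonomial a J) x) 0 := by
    have hd' : HasFDerivAt (jetMonomial a J) (fderiv ℝ (jetMonomial a J) x)
        (x + (0 : ℝ) • (Pi.single j (1 : ℝ) : Fin p → ℝ)) := by simpa using hd.hasFDerivAt
    exact HasFDerivAt.comp_hasDerivAt (l := jetMonomial a J) (0 : ℝ) hd' hline
  set C : ℝ := ∏ i ∈ Finset.univ.erase j, (x i - a i) ^ J.count i / ((J.count i).factorial : ℝ)
  have hsplit : ∀ t : ℝ, jetMonomial a J (x + t • (Pi.single j (1 : ℝ) : Fin p → ℝ)) =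
      (x j + t - a j) ^ J.count j / ((J.count j).factorial : ℝ) * C := by
    intro t
    rw [jetMonomial, ← Finset.mul_prod_erase _ _ (Finset.mem_univ j)]
    congr 1
    · simp
    · refine Finset.prod_congr rfl fun i hi => ?_
      simp [Finset.ne_of_mem_erase hi]
  have h2 : HasDerivAt (fun t : ℝ => (x j + t - a j) ^ J.count j /
      ((J.count j).factorial : ℝ) * C)
      ((J.count j : ℝ) * (x j - a j) ^ (J.count j - 1) / ((J.count j).factorial : ℝ) * C) 0 := by
    have : HasDerivAt (fun t : ℝ => x j + t - a j) 1 0 :=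
      ((hasDerivAt_id (0 : ℝ)).const_add (x j)).sub_const (a j)
    simpa using ((this.pow (J.count j)).div_const ((J.count j).factorial : ℝ)).mul_const C
  rw [h1.unique (h2.congr_of_eventuallyEq (Filter.Eventually.of_forall hsplit))]
  split_ifs with hj
  · rw [jetMonomial, ← Finset.mul_prod_erase _ _ (Finset.mem_univ j)]
    congr 1
    · obtain ⟨m, hm⟩ : ∃ m, J.count j = m + 1 :=
        Nat.exists_eq_succ_of_ne_zero (Multiset.count_pos.2 hj).ne'
      rw [Multiset.count_erase_self, hm, Nat.factorial_succ]
      have : ((m.factorial : ℕ) : ℝ) ≠ 0 := by positivity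
      push_cast
      field_simp
    · refine Finset.prod_congr rfl fun i hi => ?_
      rw [Multiset.count_erase_of_ne (Finset.ne_of_mem_erase hi)]
  · simp [Multiset.count_eq_zero_of_notMem hj]

theorem iterPartialDeriv_jetMonomial (a : Fin p → ℝ) (J : Multiset (Fin p)) (L : List (Fin p)) :
    iterPartialDeriv L (jetMonomial a J) =
      if (L : Multiset (Fin p)) ≤ J then jetMonomial a (J - L) else 0 := by
  induction L with
  | nil => simp [iterPartialDeriv]
  | cons j L ih =>
    have h1 : iterPartialDeriv (j :: L) (jetMonomial a J) =
      partialDeriv j (iterPartialDeriv L (jetMonomial a J)) := rfl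
    rw [h1, ih]
    have hiff : ((j :: L : List (Fin p)) : Multiset (Fin p)) ≤ J ↔
        (L : Multiset (Fin p)) ≤ J ∧ j ∈ J - (L : Multiset (Fin p)) := by
      rw [← Multiset.cons_coe, Multiset.le_iff_count, Multiset.le_iff_count, Multiset.mem_sub]
      constructor
      · intro h
        refine ⟨fun i => (Multiset.count_le_count_cons _ _ _).trans (h i), ?_⟩
        have := h j
        rw [Multiset.count_cons_self] at this
        omega
      · rintro ⟨h, hj⟩ i
        rw [Multiset.count_cons]
        split_ifs with hi
        · subst hi; omega
        · exact h i
    by_cases hL : (L : Multiset (Fin p)) ≤ J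
    · rw [if_pos hL, partialDeriv_jetMonomial]
      by_cases hj : j ∈ J - (L : Multiset (Fin p))
      · rw [if_pos hj, if_pos (hiff.2 ⟨hL, hj⟩), ← Multiset.cons_coe,
          ← Multiset.sub_singleton, tsub_tsub, add_comm, Multiset.singleton_add]
      · rw [if_neg hj, if_neg fun h => hj (hiff.1 h).2]
    · rw [if_neg hL, if_neg fun h => hL (hiff.1 h).1]
      funext x
      simp [partialDeriv]

theorem iterPartialDeriv_sum_mul {ι : Type*} (s : Finset ι) (c : ι → ℝ)
    (h : ι → (Fin p → ℝ) → ℝ) (hh : ∀ i, ContDiff ℝ ∞ (h i)) (L : List (Fin p)) :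
    iterPartialDeriv L (fun x => ∑ i ∈ s, c i * h i x) =
      fun x => ∑ i ∈ s, c i * iterPartialDeriv L (h i) x := by
  induction L with
  | nil => rfl
  | cons j L ih =>
    have h1 : ∀ k : (Fin p → ℝ) → ℝ, iterPartialDeriv (j :: L) k =
      partialDeriv j (iterPartialDeriv L k) := fun _ => rfl
    simp only [h1, ih]
    funext x
    have hd : ∀ i, DifferentiableAt ℝ (iterPartialDeriv L (h i)) x := fun i =>
      ((iterPartialDeriv_contDiffOn isOpen_univ L (hh i).contDiffOn).contDiffAt
        Filter.univ_mem).differentiableAt (by simp)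
    have := (HasFDerivAt.fun_sum (u := s) fun i _ => (hd i).hasFDerivAt.const_mul (c i)).fderiv
    simp only [partialDeriv, this]
    simp

/-- Every point of the jet space is the jet of a globally defined smooth function. -/
theorem exists_contDiff_jetAt_eq {n : ℕ} (w : JetSpace p q n) :
    ∃ f : (Fin p → ℝ) → Fin q → ℝ, ContDiff ℝ ∞ f ∧ jetAt n f w.1 = w := by
  -- The Taylor polynomial with coefficients `w`. At the centre, `∂_K` kills the monomial of `J`
  -- unless `K ≤ J` and `J - K = 0`, that is `J = K`.
  refine ⟨fun x α => ∑ J : MultiIndex p n, w.2 α J * jetMonomial w.1 J.1 x, ?_, ?_⟩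
  · refine contDiff_pi.2 fun α => ContDiff.sum fun J _ => ?_
    exact contDiff_const.mul (contDiff_jetMonomial _ _)
  · refine Prod.ext rfl ?_
    funext α K
    change iterPartialDeriv K.1.toList (fun x => ∑ J : MultiIndex p n, w.2 α J *
      jetMonomial w.1 J.1 x) w.1 = w.2 α K
    rw [iterPartialDeriv_sum_mul _ _ _ fun J => contDiff_jetMonomial _ _]
    simp only [iterPartialDeriv_jetMonomial, Multiset.coe_toList]
    rw [Finset.sum_eq_single K]
    · simp [jetMonomial_self]
    · intro J _ hJ
      split_ifs with h
      · rw [jetMonomial_self, if_neg, mul_zero]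
        intro h0
        exact hJ (Subtype.ext (le_antisymm (tsub_eq_zero_iff_le.1 h0) h))
      · simp
    · simp

end Monomial

/-! ### Smoothness of total derivatives -/

section Smooth

variable {p q : ℕ} {M : Set (BaseSpace p q)}

theorem contDiff_proj {n k : ℕ} (h : k ≤ n) :
    ContDiff ℝ ∞ (JetSpace.proj h : JetSpace p q n → JetSpace p q k) := by
  unfold JetSpace.proj
  fun_prop

theorem contDiff_base {n : ℕ} : ContDiff ℝ ∞ (JetSpace.base : JetSpace p q n → BaseSpace p q) := by
  unfold JetSpace.base
  fun_prop

theorem isOpen_jetsOver (hM : IsOpen M) (n : ℕ) : IsOpen (JetSpace.jetsOver M n) :=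
  hM.preimage contDiff_base.continuous

theorem totalDeriv_contDiffOn (hM : IsOpen M) {n : ℕ} (i : Fin p) {P : JetSpace p q n → ℝ}
    (hP : ContDiffOn ℝ ∞ P (JetSpace.jetsOver M n)) :
    ContDiffOn ℝ ∞ (totalDeriv i P) (JetSpace.jetsOver M (n + 1)) := by
  have hP' : ContDiffOn ℝ ∞ (fun w : JetSpace p q (n + 1) => fderiv ℝ P (w.proj n.le_succ))
      (JetSpace.jetsOver M (n + 1)) :=
    (hP.fderiv_of_isOpen (isOpen_jetsOver hM n) (m := ∞) (by simp)).comp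
      (contDiff_proj n.le_succ).contDiffOn fun w hw => hw
  unfold totalDeriv
  refine (hP'.clm_apply contDiffOn_const).add
    (ContDiffOn.sum fun α _ => ContDiffOn.sum fun J _ => ?_)
  refine ContDiffOn.mul ?_ (hP'.clm_apply contDiffOn_const)
  exact ContDiff.contDiffOn (by fun_prop)

theorem iterTotalDeriv_contDiffOn (hM : IsOpen M) {n : ℕ} {P : JetSpace p q n → ℝ}
    (hP : ContDiffOn ℝ ∞ P (JetSpace.jetsOver M n)) (L : List (Fin p)) :
    ContDiffOn ℝ ∞ (iterTotalDeriv L P) (JetSpace.jetsOver M (n + L.length)) := by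
  induction L with
  | nil => exact hP
  | cons j L ih => exact totalDeriv_contDiffOn hM j ih

theorem characteristic_contDiffOn {ξ : Fin p → BaseSpace p q → ℝ} {φ : Fin q → BaseSpace p q → ℝ}
    (hξ : ∀ i, ContDiffOn ℝ ∞ (ξ i) M) (hφ : ∀ α, ContDiffOn ℝ ∞ (φ α) M) (α : Fin q) :
    ContDiffOn ℝ ∞ (characteristic ξ φ α) (JetSpace.jetsOver M 1) := by
  unfold characteristic
  refine ((hφ α).comp contDiff_base.contDiffOn fun w hw => hw).sub (ContDiffOn.sum fun i _ => ?_)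
  refine ((hξ i).comp contDiff_base.contDiffOn fun w hw => hw).mul ?_
  exact ContDiff.contDiffOn (by fun_prop)

theorem prolongationCoeff_contDiffOn (hM : IsOpen M) {ξ : Fin p → BaseSpace p q → ℝ}
    {φ : Fin q → BaseSpace p q → ℝ} (hξ : ∀ i, ContDiffOn ℝ ∞ (ξ i) M)
    (hφ : ∀ α, ContDiffOn ℝ ∞ (φ α) M) (α : Fin q) (L : List (Fin p)) :
    ContDiffOn ℝ ∞ (prolongationCoeff ξ φ α L) (JetSpace.jetsOver M (1 + L.length)) := by
  unfold prolongationCoeff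
  refine (iterTotalDeriv_contDiffOn hM (characteristic_contDiffOn hξ hφ α) L).add
    (ContDiffOn.sum fun i _ => ?_)
  refine ((hξ i).comp contDiff_base.contDiffOn fun w hw => hw).mul ?_
  exact ContDiff.contDiffOn (by fun_prop)

theorem jetAt_base (n : ℕ) (f : (Fin p → ℝ) → Fin q → ℝ) (x : Fin p → ℝ) :
    (jetAt n f x).base = (x, f x) := by
  refine Prod.ext rfl ?_
  funext α
  simp [JetSpace.base, jetAt, iterPartialDeriv]

/-- Iterates `totalDeriv_jetAt`. The graph of `f` has to stay in `M`, since `P` is smooth only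
there. -/
theorem iterTotalDeriv_jetAt (hM : IsOpen M) {n : ℕ} {P : JetSpace p q n → ℝ}
    (hP : ContDiffOn ℝ ∞ P (JetSpace.jetsOver M n)) {Ω : Set (Fin p → ℝ)} (hΩ : IsOpen Ω)
    {f : (Fin p → ℝ) → Fin q → ℝ} (hf : ContDiffOn ℝ ∞ f Ω) (hfM : ∀ x ∈ Ω, (x, f x) ∈ M)
    (L : List (Fin p)) :
    Set.EqOn (fun x => iterTotalDeriv L P (jetAt (n + L.length) f x))
      (iterPartialDeriv L fun x => P (jetAt n f x)) Ω := by
  induction L with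
  | nil => exact fun _ _ => rfl
  | cons j L ih =>
    intro x hx
    have hmem : jetAt (n + L.length) f x ∈ JetSpace.jetsOver M (n + L.length) := by
      rw [JetSpace.jetsOver, Set.mem_ofPred_eq, jetAt_base]
      exact hfM x hx
    have hd : DifferentiableAt ℝ (iterTotalDeriv L P) (jetAt (n + L.length) f x) :=
      ((iterTotalDeriv_contDiffOn hM hP L).contDiffAt
        ((isOpen_jetsOver hM _).mem_nhds hmem)).differentiableAt (by simp)
    exact (totalDeriv_jetAt hΩ hf hx j hd).trans (partialDeriv_congr hΩ j ih hx)

end Smooth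

/-! ### Jets of transformed functions -/

/-- If `g` maps the graphs of `f₀` and `f₁` to the graphs of `f₀'` and `f₁'`, and `f₀`, `f₁` have
the same jet, then so have `f₀'`, `f₁'`, provided that the map induced by `g` and `f₀` on the
independent variables has a smooth right inverse `r`. -/
theorem EqJet.of_transformed {p q n : ℕ} {g : BaseSpace p q → BaseSpace p q}
    {f₀ f₁ f₀' f₁' : (Fin p → ℝ) → Fin q → ℝ} {x₀ y₀ : Fin p → ℝ}
    (hg : ContDiffAt ℝ ∞ g (x₀, f₀ x₀)) (hy₀ : (g (x₀, f₀ x₀)).1 = y₀)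
    (hf₀ : ContDiffAt ℝ ∞ f₀ x₀) (hf₁ : ContDiffAt ℝ ∞ f₁ x₀) (hff : EqJet n f₀ f₁ x₀)
    (hf₀' : ContDiffAt ℝ ∞ f₀' y₀) (hf₁' : ContDiffAt ℝ ∞ f₁' y₀)
    (h₀ : ∀ᶠ x in 𝓝 x₀, f₀' (g (x, f₀ x)).1 = (g (x, f₀ x)).2)
    (h₁ : ∀ᶠ x in 𝓝 x₀, f₁' (g (x, f₁ x)).1 = (g (x, f₁ x)).2)
    {r : (Fin p → ℝ) → Fin p → ℝ} (hr : ContDiffAt ℝ ∞ r y₀) (hry : r y₀ = x₀)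
    (hgr : ∀ᶠ y in 𝓝 y₀, (g (r y, f₀ (r y))).1 = y) : EqJet n f₀' f₁' y₀ := by
  have hG₀ : ContDiffAt ℝ ∞ (fun x => g (x, f₀ x)) x₀ := hg.comp x₀ (contDiffAt_id.prodMk hf₀)
  have hG₁ : ContDiffAt ℝ ∞ (fun x => g (x, f₁ x)) x₀ :=
    ContDiffAt.comp (g := g) x₀ (by rw [← hff.apply_eq]; exact hg) (contDiffAt_id.prodMk hf₁)
  have hG : EqJet n (fun x => g (x, f₀ x)) (fun x => g (x, f₁ x)) x₀ :=
    EqJet.comp (g := g) (g' := g) (EqJet.refl n g _)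
      ((EqJet.refl n id x₀).prodMk hff contDiffAt_id contDiffAt_id hf₀ hf₁)
      hg hg (contDiffAt_id.prodMk hf₀) (contDiffAt_id.prodMk hf₁)
  have ha : EqJet n (fun x => (g (x, f₀ x)).1) (fun x => (g (x, f₁ x)).1) x₀ :=
    EqJet.comp (EqJet.refl n Prod.fst _) hG contDiffAt_fst contDiffAt_fst hG₀ hG₁
  have hb : EqJet n (fun x => (g (x, f₀ x)).2) (fun x => (g (x, f₁ x)).2) x₀ :=
    EqJet.comp (EqJet.refl n Prod.snd _) hG contDiffAt_snd contDiffAt_snd hG₀ hG₁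
  have ha₀ : ContDiffAt ℝ ∞ (fun x => (g (x, f₀ x)).1) x₀ := hG₀.fst
  have ha₁ : ContDiffAt ℝ ∞ (fun x => (g (x, f₁ x)).1) x₀ := hG₁.fst
  subst hy₀
  have h2 : EqJet n (f₁' ∘ fun x => (g (x, f₀ x)).1) (f₁' ∘ fun x => (g (x, f₁ x)).1) x₀ :=
    EqJet.comp (EqJet.refl n f₁' _) ha hf₁' hf₁' ha₀ ha₁
  -- With `a` and `b` the two components of `g (x, f x)`, the chain is `f₀' ∘ a₀ = b₀ ~ b₁ = f₁' ∘
  -- a₁ ~ f₁' ∘ a₀`.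
  have h3 : EqJet n (f₀' ∘ fun x => (g (x, f₀ x)).1) (f₁' ∘ fun x => (g (x, f₀ x)).1) x₀ :=
    ((Filter.EventuallyEq.eqJet h₀ n).trans hb).trans
      ((Filter.EventuallyEq.eqJet h₁ n).symm.trans h2.symm)
  set y₀ := (g (x₀, f₀ x₀)).1
  -- Composing with the right inverse `r` now cancels the common inner map `a₀`.
  have h4 : ∀ F : (Fin p → ℝ) → Fin q → ℝ,
      EqJet n ((F ∘ fun x => (g (x, f₀ x)).1) ∘ r) F y₀ := fun F =>
    Filter.EventuallyEq.eqJet (hgr.mono fun y hy => congrArg F hy) n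
  refine (h4 f₀').symm.trans (EqJet.trans ?_ (h4 f₁'))
  refine EqJet.comp (by rwa [hry]) (EqJet.refl n r _) ?_ ?_ hr hr
  · rw [hry]; exact hf₀'.comp x₀ ha₀
  · rw [hry]; exact hf₁'.comp x₀ ha₀

/-! ### Iterated partial derivatives of functions depending on a parameter -/

section Parameter

variable {p : ℕ}

/-- `∂_{j₁} ⋯ ∂_{j_k} h` for a function `h` of `(ε, x)`, the derivatives being taken in `x`. -/
noncomputable def paramIterPartialDeriv (L : List (Fin p)) (h : ℝ × (Fin p → ℝ) → ℝ) :
    ℝ × (Fin p → ℝ) → ℝ :=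
  L.foldr (fun i k s => fderiv ℝ k s (0, Pi.single i 1)) h

variable {T : Set (ℝ × (Fin p → ℝ))} {k : ℝ × (Fin p → ℝ) → ℝ}

theorem contDiffOn_fderiv_apply (hT : IsOpen T) (hk : ContDiffOn ℝ ∞ k T)
    (v : ℝ × (Fin p → ℝ)) : ContDiffOn ℝ ∞ (fun s => fderiv ℝ k s v) T :=
  (hk.fderiv_of_isOpen hT (m := ∞) (by simp)).clm_apply contDiffOn_const

theorem paramIterPartialDeriv_contDiffOn (hT : IsOpen T) (hk : ContDiffOn ℝ ∞ k T)
    (L : List (Fin p)) : ContDiffOn ℝ ∞ (paramIterPartialDeriv L k) T := by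
  induction L with
  | nil => exact hk
  | cons j L ih => exact contDiffOn_fderiv_apply hT ih _

theorem paramIterPartialDeriv_eq (hT : IsOpen T) (hk : ContDiffOn ℝ ∞ k T) (L : List (Fin p))
    (ε : ℝ) : Set.EqOn (iterPartialDeriv L fun y => k (ε, y))
      (fun y => paramIterPartialDeriv L k (ε, y)) {y | (ε, y) ∈ T} := by
  have ho : IsOpen {y | (ε, y) ∈ T} := hT.preimage (Continuous.prodMk_right ε)
  induction L with
  | nil => exact fun _ _ => rfl
  | cons j L ih =>
    intro y hy
    have hd : DifferentiableAt ℝ (paramIterPartialDeriv L k) (ε, y) :=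
      ((paramIterPartialDeriv_contDiffOn hT hk L).contDiffAt
        (hT.mem_nhds hy)).differentiableAt (by simp)
    have h1 := (hd.hasFDerivAt.comp y (hasFDerivAt_prodMk_right ε y)).fderiv
    refine (partialDeriv_congr ho j ih hy).trans ?_
    exact congrArg (fun A : (Fin p → ℝ) →L[ℝ] ℝ => A (Pi.single j 1)) h1

theorem fderiv_fderiv_apply_comm (hT : IsOpen T) (hk : ContDiffOn ℝ ∞ k T)
    (u v : ℝ × (Fin p → ℝ)) {s : ℝ × (Fin p → ℝ)} (hs : s ∈ T) :
    fderiv ℝ (fun s => fderiv ℝ k s v) s u = fderiv ℝ (fun s => fderiv ℝ k s u) s v := by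
  have hs' : ContDiffAt ℝ ∞ k s := hk.contDiffAt (hT.mem_nhds hs)
  have hsymm : IsSymmSndFDerivAt ℝ k s := hs'.isSymmSndFDerivAt
    (by rw [minSmoothness_of_isRCLikeNormedField]; exact WithTop.coe_le_coe.2 le_top)
  have hd : DifferentiableAt ℝ (fderiv ℝ k) s :=
    ((hk.fderiv_of_isOpen hT (m := ∞) (by simp)).contDiffAt (hT.mem_nhds hs)).differentiableAt
      (by simp)
  have key : ∀ a b, fderiv ℝ (fun s => fderiv ℝ k s b) s a = fderiv ℝ (fderiv ℝ k) s a b := by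
    intro a b
    rw [(hd.hasFDerivAt.clm_apply (hasFDerivAt_const b s)).fderiv]
    simp
  rw [key, key]
  exact hsymm _ _

theorem fderiv_paramIterPartialDeriv_apply (hT : IsOpen T) (hk : ContDiffOn ℝ ∞ k T)
    (u : ℝ × (Fin p → ℝ)) (L : List (Fin p)) :
    Set.EqOn (fun s => fderiv ℝ (paramIterPartialDeriv L k) s u)
      (paramIterPartialDeriv L fun s => fderiv ℝ k s u) T := by
  induction L with
  | nil => exact fun _ _ => rfl
  | cons j L ih =>
    intro s hs
    refine (fderiv_fderiv_apply_comm hT (paramIterPartialDeriv_contDiffOn hT hk L) u _ hs).trans ?_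
    have : (fun s => fderiv ℝ (paramIterPartialDeriv L k) s u) =ᶠ[𝓝 s]
      (paramIterPartialDeriv L fun s => fderiv ℝ k s u) :=
      Filter.eventuallyEq_of_mem (hT.mem_nhds hs) ih
    rw [this.fderiv_eq]
    rfl

theorem fderiv_prod_apply_eq_add_sum (A : ℝ × (Fin p → ℝ) →L[ℝ] ℝ) (v : Fin p → ℝ) :
    A (1, v) = A (1, 0) + ∑ i, v i * A (0, Pi.single i 1) := by
  have : ((1, v) : ℝ × (Fin p → ℝ)) =
      (1, 0) + ∑ i, v i • ((0, Pi.single i 1) : ℝ × (Fin p → ℝ)) := by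
    refine Prod.ext ?_ ?_
    · simp [Prod.fst_sum]
    · funext j
      simp [Prod.snd_sum, Finset.sum_apply, Pi.single_apply]
  rw [this, map_add, map_sum]
  simp only [map_smul, smul_eq_mul]

/-- Chain rule along `(ε, a ε)`: the `ε`-direction contributes the first term, after the
`ε`-derivative is moved inside `∂_L` by symmetry of second derivatives; the motion of `a`
contributes the sum. -/
theorem hasDerivAt_iterPartialDeriv_curve (hT : IsOpen T) (hk : ContDiffOn ℝ ∞ k T)
    {a : ℝ → Fin p → ℝ} {v x : Fin p → ℝ} (ha : HasDerivAt a v 0) (ha0 : a 0 = x)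
    (hx : (0, x) ∈ T) (L : List (Fin p)) :
    HasDerivAt (fun ε => iterPartialDeriv L (fun y => k (ε, y)) (a ε))
      (iterPartialDeriv L (fun y => fderiv ℝ k (0, y) (1, 0)) x +
        ∑ i, v i * iterPartialDeriv (i :: L) (fun y => k (0, y)) x) 0 := by
  have hcurve : HasDerivAt (fun ε => (ε, a ε)) (1, v) (0 : ℝ) := (hasDerivAt_id 0).prodMk ha
  have hd : HasFDerivAt (paramIterPartialDeriv L k) (fderiv ℝ (paramIterPartialDeriv L k) (0, x))
      (0, x) := (((paramIterPartialDeriv_contDiffOn hT hk L).contDiffAt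
        (hT.mem_nhds hx)).differentiableAt (by simp)).hasFDerivAt
  have h1 := hd.comp_hasDerivAt_of_eq (0 : ℝ) hcurve (by rw [ha0])
  have hev : ∀ᶠ ε in 𝓝 (0 : ℝ), (ε, a ε) ∈ T :=
    hcurve.continuousAt.eventually (hT.mem_nhds (ha0.symm ▸ hx : (0, a 0) ∈ T))
  rw [fderiv_prod_apply_eq_add_sum] at h1
  have h2 : iterPartialDeriv L (fun y => fderiv ℝ k (0, y) (1, 0)) x =
      fderiv ℝ (paramIterPartialDeriv L k) (0, x) (1, 0) :=
    (paramIterPartialDeriv_eq hT (contDiffOn_fderiv_apply hT hk (1, 0)) L 0 hx).trans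
      (fderiv_paramIterPartialDeriv_apply hT hk (1, 0) L hx).symm
  have h3 : ∀ i, iterPartialDeriv (i :: L) (fun y => k (0, y)) x =
      fderiv ℝ (paramIterPartialDeriv L k) (0, x) (0, Pi.single i 1) := fun i =>
    paramIterPartialDeriv_eq hT hk (i :: L) 0 hx
  rw [h2]
  simp only [h3]
  exact h1.congr_of_eventuallyEq (hev.mono fun ε hε => paramIterPartialDeriv_eq hT hk L ε hε)

end Parameter

/-! ### The flow acting on the graph of a function -/

section Flow

variable {p q : ℕ} {M : Set (BaseSpace p q)}

/-- The set of `(ε, x)` such that `Φ_ε (x, f x)` is defined. -/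
def graphDom (Φ : LocalOneParamGroup M) (f : (Fin p → ℝ) → Fin q → ℝ) : Set (ℝ × (Fin p → ℝ)) :=
  {s | (s.1, (s.2, f s.2)) ∈ Φ.dom}

theorem isOpen_graphDom (Φ : LocalOneParamGroup M) {f : (Fin p → ℝ) → Fin q → ℝ}
    (hf : Continuous f) : IsOpen (graphDom Φ f) :=
  Φ.isOpen_dom.preimage (by fun_prop : Continuous fun s : ℝ × (Fin p → ℝ) => (s.1, (s.2, f s.2)))

theorem contDiffOn_act_graph (Φ : LocalOneParamGroup M) {f : (Fin p → ℝ) → Fin q → ℝ}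
    (hf : ContDiff ℝ ∞ f) :
    ContDiffOn ℝ ∞ (fun s : ℝ × (Fin p → ℝ) => Φ.act s.1 (s.2, f s.2)) (graphDom Φ f) :=
  Φ.contDiffOn_act.comp (t := Φ.dom) (s := graphDom Φ f)
    (f := fun s : ℝ × (Fin p → ℝ) => (s.1, (s.2, f s.2)))
    (by fun_prop : ContDiff ℝ ∞ fun s : ℝ × (Fin p → ℝ) => (s.1, (s.2, f s.2))).contDiffOn
    fun _ hs => hs

/-- The shear `(s, x) ↦ (s, x + s v)`. -/
noncomputable def shearEquiv {E : Type*} [NormedAddCommGroup E] [NormedSpace ℝ E] (v : E) :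
    (ℝ × E) ≃L[ℝ] (ℝ × E) :=
  ContinuousLinearEquiv.equivOfInverse
    ((ContinuousLinearMap.fst ℝ ℝ E).prod
      (ContinuousLinearMap.snd ℝ ℝ E + (ContinuousLinearMap.fst ℝ ℝ E).smulRight v))
    ((ContinuousLinearMap.fst ℝ ℝ E).prod
      (ContinuousLinearMap.snd ℝ ℝ E - (ContinuousLinearMap.fst ℝ ℝ E).smulRight v))
    (fun s => by simp) (fun s => by simp)

/-- Keeping `ε` as a coordinate lets one use of the inverse function theorem treat all small `ε` at
once, with joint smoothness. The derivative at `(0, x₀)` is read off on the two axes: the generator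
along `ε`, and the identity along `x` because `Φ_0 = id`. -/
theorem exists_openPartialHomeomorph_act_graph (hM : IsOpen M) (Φ : LocalOneParamGroup M)
    {v : BaseSpace p q → BaseSpace p q} (hΦ : Φ.IsGeneratedBy v)
    {f : (Fin p → ℝ) → Fin q → ℝ} (hf : ContDiff ℝ ∞ f) {x₀ : Fin p → ℝ} (hx₀ : (x₀, f x₀) ∈ M) :
    ∃ e : OpenPartialHomeomorph (ℝ × (Fin p → ℝ)) (ℝ × (Fin p → ℝ)),
      (∀ s, e s = (s.1, (Φ.act s.1 (s.2, f s.2)).1)) ∧ (0, x₀) ∈ e.source ∧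
      e.source ⊆ graphDom Φ f ∧ ContDiffOn ℝ ∞ e.symm e.target := by
  set H : ℝ × (Fin p → ℝ) → ℝ × (Fin p → ℝ) := fun s => (s.1, (Φ.act s.1 (s.2, f s.2)).1) with hH
  have hW := isOpen_graphDom Φ hf.continuous
  have h0 : ((0 : ℝ), x₀) ∈ graphDom Φ f := Φ.zero_mem_dom _ hx₀
  have hHs : ContDiffOn ℝ ∞ H (graphDom Φ f) :=
    contDiffOn_fst.prodMk (contDiffOn_act_graph Φ hf).fst
  have hd : HasFDerivAt H (fderiv ℝ H (0, x₀)) (0, x₀) :=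
    ((hHs.contDiffAt (hW.mem_nhds h0)).differentiableAt (by simp)).hasFDerivAt
  have hA : fderiv ℝ H (0, x₀) = (shearEquiv (v (x₀, f x₀)).1 : _ →L[ℝ] _) := by
    have h1 : HasDerivAt (fun ε => H (ε, x₀)) (fderiv ℝ H (0, x₀) (1, 0)) 0 :=
      HasFDerivAt.comp_hasDerivAt (l := H) (0 : ℝ) hd
        ((hasDerivAt_id (0 : ℝ)).prodMk (hasDerivAt_const (0 : ℝ) x₀))
    have h1' : HasDerivAt (fun ε => H (ε, x₀)) (1, (v (x₀, f x₀)).1) 0 :=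
      (hasDerivAt_id (0 : ℝ)).prodMk (hΦ _ hx₀).fst
    have h2 : HasFDerivAt (fun x => H (0, x))
        ((fderiv ℝ H (0, x₀)).comp (ContinuousLinearMap.inr ℝ ℝ (Fin p → ℝ))) x₀ :=
      HasFDerivAt.comp (g := H) x₀ hd (hasFDerivAt_prodMk_right 0 x₀)
    have hev : ∀ᶠ x in 𝓝 x₀, H (0, x) = (0, x) := by
      have : ContinuousAt (fun x => (x, f x)) x₀ := by
        have := hf.continuous
        fun_prop
      filter_upwards [this.eventually (hM.mem_nhds hx₀)] with x hx
      simp [hH, Φ.act_zero _ hx]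
    have h2' : HasFDerivAt (fun x => H (0, x)) (ContinuousLinearMap.inr ℝ ℝ (Fin p → ℝ)) x₀ :=
      (hasFDerivAt_prodMk_right (0 : ℝ) x₀).congr_of_eventuallyEq hev
    have e1 := h1.unique h1'
    have e2 := h2.unique h2'
    refine ContinuousLinearMap.prod_ext ?_ ?_
    · ext
      · simp [e1, shearEquiv]
      · simp [e1, shearEquiv]
    · rw [e2]
      ext <;> simp [shearEquiv]
  rw [hA] at hd
  obtain ⟨e, he, h⟩ := exists_openPartialHomeomorph_contDiffOn_symm hW hHs h0 _ hd
  exact ⟨e, fun s => by rw [he], h⟩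

end Flow

/-! ### The transformed functions and the derivative of their jets at `ε = 0`. -/

theorem iterPartialDeriv_congr {p : ℕ} {Ω : Set (Fin p → ℝ)} (hΩ : IsOpen Ω) (L : List (Fin p))
    {h k : (Fin p → ℝ) → ℝ} (hhk : Set.EqOn h k Ω) :
    Set.EqOn (iterPartialDeriv L h) (iterPartialDeriv L k) Ω := by
  induction L with
  | nil => exact hhk
  | cons j L ih => exact partialDeriv_congr hΩ j ih

theorem jetAt_snd_coe {p q n : ℕ} {Ω : Set (Fin p → ℝ)} (hΩ : IsOpen Ω)
    {f : (Fin p → ℝ) → Fin q → ℝ} (hf : ContDiffOn ℝ ∞ f Ω) {x : Fin p → ℝ} (hx : x ∈ Ω)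
    (α : Fin q) (L : List (Fin p)) (hL : (L : Multiset (Fin p)).card ≤ n) :
    (jetAt n f x).2 α ⟨(L : Multiset (Fin p)), hL⟩ = iterPartialDeriv L (fun y => f y α) x := by
  have hp : (L : Multiset (Fin p)).toList.Perm L := by
    rw [← Multiset.coe_eq_coe, Multiset.coe_toList]
  exact iterPartialDeriv_perm hΩ hp (contDiffOn_pi.1 hf α) hx

/-- A family of functions `y ↦ F (ε, y)`, for small `ε`, whose graphs are the images under `Φ_ε` of
the graph of `f` near `x₀`: `chart` is a local diffeomorphism `(ε, x) ↦ (ε, y)`, where `y` is the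
`X`-component of `Φ_ε (x, f x)`. -/
structure TransformedFamily {p q : ℕ} {M : Set (BaseSpace p q)} (Φ : LocalOneParamGroup M)
    (f : (Fin p → ℝ) → Fin q → ℝ) (x₀ : Fin p → ℝ) where
  /-- the local diffeomorphism `(ε, x) ↦ (ε, y)` -/
  chart : OpenPartialHomeomorph (ℝ × (Fin p → ℝ)) (ℝ × (Fin p → ℝ))
  /-- the transformed functions -/
  F : ℝ × (Fin p → ℝ) → Fin q → ℝ
  chart_apply : ∀ s, chart s = (s.1, (Φ.act s.1 (s.2, f s.2)).1)
  mem_source : (0, x₀) ∈ chart.source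
  source_subset : chart.source ⊆ graphDom Φ f
  contDiffOn_symm : ContDiffOn ℝ ∞ chart.symm chart.target
  contDiffOn_F : ContDiffOn ℝ ∞ F chart.target
  F_chart : ∀ s ∈ chart.source, F (chart s) = (Φ.act s.1 (s.2, f s.2)).2

namespace TransformedFamily

variable {p q : ℕ} {M : Set (BaseSpace p q)} {Φ : LocalOneParamGroup M}
  {f : (Fin p → ℝ) → Fin q → ℝ} {x₀ : Fin p → ℝ}

theorem nonempty (hM : IsOpen M) (Φ : LocalOneParamGroup M)
    {v : BaseSpace p q → BaseSpace p q} (hΦ : Φ.IsGeneratedBy v) (hf : ContDiff ℝ ∞ f)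
    (hx₀ : (x₀, f x₀) ∈ M) : Nonempty (TransformedFamily Φ f x₀) := by
  obtain ⟨e, he, h0, hsub, hsymm⟩ := exists_openPartialHomeomorph_act_graph hM Φ hΦ hf hx₀
  -- `F` pulls `(ε, y)` back to `(ε, x)` and takes the `U`-component of `Φ_ε (x, f x)`.
  refine ⟨⟨e, fun t => (Φ.act (e.symm t).1 ((e.symm t).2, f (e.symm t).2)).2, he, h0, hsub, hsymm,
    ?_, fun s hs => by rw [e.left_inv hs]⟩⟩
  exact ((contDiffOn_act_graph Φ hf).snd).comp hsymm fun t ht => hsub (e.map_target ht)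

variable (T : TransformedFamily Φ f x₀)

theorem isOpen_sourceAt (ε : ℝ) : IsOpen {x | (ε, x) ∈ T.chart.source} :=
  T.chart.open_source.preimage (Continuous.prodMk_right ε)

theorem isOpen_targetAt (ε : ℝ) : IsOpen {y | (ε, y) ∈ T.chart.target} :=
  T.chart.open_target.preimage (Continuous.prodMk_right ε)

theorem contDiffOn_F_at (ε : ℝ) :
    ContDiffOn ℝ ∞ (fun y => T.F (ε, y)) {y | (ε, y) ∈ T.chart.target} :=
  T.contDiffOn_F.comp (contDiff_prodMk_right ε).contDiffOn fun _ hy => hy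

theorem act_mem_target {ε : ℝ} {x : Fin p → ℝ} (hx : (ε, x) ∈ T.chart.source) :
    (ε, (Φ.act ε (x, f x)).1) ∈ T.chart.target := by
  have := T.chart.map_source hx
  rwa [T.chart_apply] at this

theorem F_act {ε : ℝ} {x : Fin p → ℝ} (hx : (ε, x) ∈ T.chart.source) :
    T.F (ε, (Φ.act ε (x, f x)).1) = (Φ.act ε (x, f x)).2 := by
  have := T.F_chart _ hx
  rwa [T.chart_apply] at this

theorem symm_apply {ε : ℝ} {y : Fin p → ℝ} (hy : (ε, y) ∈ T.chart.target) :
    ∃ x, T.chart.symm (ε, y) = (ε, x) ∧ (ε, x) ∈ T.chart.source ∧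
      (Φ.act ε (x, f x)).1 = y := by
  have h1 := T.chart.right_inv hy
  rw [T.chart_apply, Prod.ext_iff] at h1
  have h2 : T.chart.symm (ε, y) = (ε, (T.chart.symm (ε, y)).2) := Prod.ext h1.1 rfl
  refine ⟨_, h2, h2 ▸ T.chart.map_target hy, ?_⟩
  have h3 := h1.2
  simp only at h3
  rwa [show (T.chart.symm (ε, y)).1 = ε from h1.1] at h3

theorem mem_of_zero_mem_source {x : Fin p → ℝ} (hx : (0, x) ∈ T.chart.source) : (x, f x) ∈ M :=
  Φ.mem_of_dom _ _ (T.source_subset hx)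

theorem zero_mem_target {x : Fin p → ℝ} (hx : (0, x) ∈ T.chart.source) :
    (0, x) ∈ T.chart.target := by
  have := T.act_mem_target hx
  rwa [Φ.act_zero _ (T.mem_of_zero_mem_source hx)] at this

theorem F_zero {x : Fin p → ℝ} (hx : (0, x) ∈ T.chart.source) : T.F (0, x) = f x := by
  have := T.F_act hx
  rwa [Φ.act_zero _ (T.mem_of_zero_mem_source hx)] at this

theorem image_graphOn (ε : ℝ) :
    Φ.act ε '' Set.graphOn f {x | (ε, x) ∈ T.chart.source} =
      Set.graphOn (fun y => T.F (ε, y)) {y | (ε, y) ∈ T.chart.target} := by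
  ext m
  constructor
  · rintro ⟨_, ⟨x, hx, rfl⟩, rfl⟩
    exact ⟨_, T.act_mem_target hx, Prod.ext rfl (T.F_act hx)⟩
  · rintro ⟨y, hy, rfl⟩
    obtain ⟨x, -, hx, rfl⟩ := T.symm_apply hy
    exact ⟨_, ⟨x, hx, rfl⟩, Prod.ext rfl (T.F_act hx).symm⟩

theorem prolongedMapsTo (hf : ContDiff ℝ ∞ f) (n : ℕ) {ε : ℝ} (hε : (ε, x₀) ∈ T.chart.source) :
    ProlongedMapsTo n (Φ.act ε) (Φ.domAt ε) (jetAt n f x₀)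
      (jetAt n (fun y => T.F (ε, y)) (Φ.act ε (x₀, f x₀)).1) := by
  refine ⟨_, _, f, fun y => T.F (ε, y), T.isOpen_sourceAt ε, hε, hf.contDiffOn, ?_, rfl,
    T.isOpen_targetAt ε, T.contDiffOn_F_at ε, T.image_graphOn ε, by rw [jetAt_base]⟩
  rintro _ ⟨x, hx, rfl⟩
  exact T.source_subset hx

/-- Independence of the representative: a competing `f₁` has the same `n`-jet as `f`, so
`EqJet.of_transformed` applies, with the `ε`-slice of the inverse chart as right inverse. -/
theorem eq_of_prolongedMapsTo (hf : ContDiff ℝ ∞ f) {n : ℕ} {ε : ℝ}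
    (hε : (ε, x₀) ∈ T.chart.source) {z' : JetSpace p q n}
    (hz' : ProlongedMapsTo n (Φ.act ε) (Φ.domAt ε) (jetAt n f x₀) z') :
    z' = jetAt n (fun y => T.F (ε, y)) (Φ.act ε (x₀, f x₀)).1 := by
  obtain ⟨Ω, Ω', f₁, f₁', hΩ, hx₀, hf₁, -, hjet, hΩ', hf₁', himg, rfl⟩ := hz'
  rw [jetAt_base]
  change x₀ ∈ Ω at hx₀
  change jetAt n f₁ x₀ = jetAt n f x₀ at hjet
  have hff : EqJet n f f₁ x₀ := (jetAt_eq_iff_eqJet hΩ hf.contDiffOn hf₁ hx₀).1 hjet.symm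
  have hgraph : ∀ x ∈ Ω, (Φ.act ε (x, f₁ x)).1 ∈ Ω' ∧
      f₁' (Φ.act ε (x, f₁ x)).1 = (Φ.act ε (x, f₁ x)).2 := by
    intro x hx
    have : Φ.act ε (x, f₁ x) ∈ Ω'.graphOn f₁' := himg ▸ ⟨_, ⟨x, hx, rfl⟩, rfl⟩
    obtain ⟨y, hy, hyx⟩ := this
    rw [← hyx]
    exact ⟨hy, rfl⟩
  have hy₀ : (Φ.act ε (x₀, f x₀)).1 ∈ Ω' := by
    rw [hff.apply_eq]
    exact (hgraph x₀ hx₀).1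
  have hy₀T := T.act_mem_target hε
  have hg : ContDiffAt ℝ ∞ (Φ.act ε) (x₀, f x₀) :=
    ContDiffAt.comp (g := fun y : ℝ × BaseSpace p q => Φ.act y.1 y.2) (x₀, f x₀)
      (Φ.contDiffOn_act.contDiffAt (Φ.isOpen_dom.mem_nhds (T.source_subset hε)))
      (contDiff_prodMk_right ε).contDiffAt
  refine (jetAt_eq_iff_eqJet (hΩ'.inter (T.isOpen_targetAt ε)) (hf₁'.mono Set.inter_subset_left)
    ((T.contDiffOn_F_at ε).mono Set.inter_subset_right) ⟨hy₀, hy₀T⟩).2 (EqJet.symm ?_)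
  have hr : ContDiffOn ℝ ∞ (fun y => (T.chart.symm (ε, y)).2) {y | (ε, y) ∈ T.chart.target} :=
    (T.contDiffOn_symm.comp (contDiff_prodMk_right ε).contDiffOn fun _ hy => hy).snd
  refine EqJet.of_transformed hg rfl hf.contDiffAt (hf₁.contDiffAt (hΩ.mem_nhds hx₀)) hff
    ((T.contDiffOn_F_at ε).contDiffAt ((T.isOpen_targetAt ε).mem_nhds hy₀T))
    (hf₁'.contDiffAt (hΩ'.mem_nhds hy₀)) ?_ ?_
    (hr.contDiffAt ((T.isOpen_targetAt ε).mem_nhds hy₀T)) ?_ ?_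
  · filter_upwards [(T.isOpen_sourceAt ε).mem_nhds hε] with x hx using T.F_act hx
  · filter_upwards [hΩ.mem_nhds hx₀] with x hx using (hgraph x hx).2
  · have := T.chart.left_inv hε
    rw [T.chart_apply] at this
    exact congrArg Prod.snd this
  · filter_upwards [(T.isOpen_targetAt ε).mem_nhds hy₀T] with y hy
    obtain ⟨x, hx, -, hxy⟩ := T.symm_apply hy
    rw [hx, hxy]

variable {ξ : Fin p → BaseSpace p q → ℝ} {φ : Fin q → BaseSpace p q → ℝ}

/-- Differentiate `T.F_act` in `ε` at `0` and solve for the `ε`-derivative of `F`. Equality is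
needed on a whole neighbourhood of `x₀`, because it is then differentiated in `x`. -/
theorem fderiv_F_zero (hΦ : Φ.IsGeneratedBy (vectorField ξ φ)) (α : Fin q) :
    Set.EqOn (fun x => fderiv ℝ (fun s => T.F s α) (0, x) (1, 0))
      (fun x => characteristic ξ φ α (jetAt 1 f x)) {x | (0, x) ∈ T.chart.source} := by
  intro x hx
  have hxM := T.mem_of_zero_mem_source hx
  have hxT := T.zero_mem_target hx
  have hF : ContDiffOn ℝ ∞ (fun s => T.F s α) T.chart.target := contDiffOn_pi.1 T.contDiffOn_F α
  have hd : HasFDerivAt (fun s => T.F s α) (fderiv ℝ (fun s => T.F s α) (0, x)) (0, x) :=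
    ((hF.contDiffAt (T.chart.open_target.mem_nhds hxT)).differentiableAt (by simp)).hasFDerivAt
  have hcurve : HasDerivAt (fun ε => (ε, (Φ.act ε (x, f x)).1)) (1, fun i => ξ i (x, f x))
      (0 : ℝ) := (hasDerivAt_id 0).prodMk (hΦ _ hxM).fst
  have h1 := hd.comp_hasDerivAt_of_eq (0 : ℝ) hcurve (by rw [Φ.act_zero _ hxM])
  have h2 : HasDerivAt (fun ε => (Φ.act ε (x, f x)).2 α) (φ α (x, f x)) 0 :=
    hasDerivAt_pi.1 (hΦ _ hxM).snd α
  have hev : ∀ᶠ ε in 𝓝 (0 : ℝ), (ε, x) ∈ T.chart.source :=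
    (Continuous.prodMk_left x).continuousAt.eventually (T.chart.open_source.mem_nhds hx)
  have h3 := h2.unique (h1.congr_of_eventuallyEq
    (hev.mono fun ε hε => (congrFun (T.F_act hε) α).symm))
  rw [fderiv_prod_apply_eq_add_sum] at h3
  have h4 : ∀ i, fderiv ℝ (fun s => T.F s α) (0, x) (0, Pi.single i 1) =
      (jetAt 1 f x).2 α ⟨{i}, by simp⟩ := by
    intro i
    have h5 : (jetAt 1 f x).2 α ⟨{i}, by simp⟩ = partialDeriv i (fun y => f y α) x := by
      simp [jetAt, iterPartialDeriv]
    rw [h5, partialDeriv_congr (T.isOpen_sourceAt 0) i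
      (fun y hy => (congrFun (T.F_zero hy) α).symm : Set.EqOn _ (fun y => T.F (0, y) α) _) hx]
    exact (paramIterPartialDeriv_eq T.chart.open_target hF [i] 0 hxT).symm
  simp only [h4] at h3
  simp only [characteristic, jetAt_base, h3]
  ring

theorem hasDerivAt_jetAt (hM : IsOpen M) (hξ : ∀ i, ContDiffOn ℝ ∞ (ξ i) M)
    (hφ : ∀ α, ContDiffOn ℝ ∞ (φ α) M) (hΦ : Φ.IsGeneratedBy (vectorField ξ φ))
    (hf : ContDiff ℝ ∞ f) (n : ℕ) (α : Fin q) (L : List (Fin p))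
    (hL : (L : Multiset (Fin p)).card ≤ n) :
    HasDerivAt (fun ε => (jetAt n (fun y => T.F (ε, y)) (Φ.act ε (x₀, f x₀)).1).2 α
      ⟨(L : Multiset (Fin p)), hL⟩)
      (prolongationCoeff ξ φ α L (jetAt (1 + L.length) f x₀)) 0 := by
  have hxM := T.mem_of_zero_mem_source T.mem_source
  have hxT := T.zero_mem_target T.mem_source
  have hF : ContDiffOn ℝ ∞ (fun s => T.F s α) T.chart.target := contDiffOn_pi.1 T.contDiffOn_F α
  have ha : HasDerivAt (fun ε => (Φ.act ε (x₀, f x₀)).1) (fun i => ξ i (x₀, f x₀)) 0 :=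
    (hΦ _ hxM).fst
  have h1 := hasDerivAt_iterPartialDeriv_curve T.chart.open_target hF ha
    (by rw [Φ.act_zero _ hxM]) hxT L
  have hev : ∀ᶠ ε in 𝓝 (0 : ℝ), (ε, x₀) ∈ T.chart.source :=
    (Continuous.prodMk_left x₀).continuousAt.eventually
      (T.chart.open_source.mem_nhds T.mem_source)
  have h2 := h1.congr_of_eventuallyEq (hev.mono fun ε hε =>
    jetAt_snd_coe (n := n) (T.isOpen_targetAt ε) (T.contDiffOn_F_at ε) (T.act_mem_target hε) α L hL)
  refine h2.congr_deriv (Eq.symm ?_)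
  unfold prolongationCoeff
  congr 1
  · rw [iterPartialDeriv_congr (T.isOpen_sourceAt 0) L (T.fderiv_F_zero hΦ α) T.mem_source]
    exact iterTotalDeriv_jetAt hM (characteristic_contDiffOn hξ hφ α) (T.isOpen_sourceAt 0)
      hf.contDiffOn (fun x hx => T.mem_of_zero_mem_source hx) L T.mem_source
  · refine Finset.sum_congr rfl fun i _ => ?_
    rw [jetAt_base, iterPartialDeriv_congr (T.isOpen_sourceAt 0) (i :: L)
      (fun y hy => congrFun (T.F_zero hy) α : Set.EqOn _ (fun y => f y α) _) T.mem_source]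
    congr 1
    exact jetAt_snd_coe isOpen_univ hf.contDiffOn (Set.mem_univ x₀) α (i :: L) _

end TransformedFamily

/-! ### The prolongation formula -/

section Prolongation

variable {p q : ℕ} {M : Set (BaseSpace p q)} {ξ : Fin p → BaseSpace p q → ℝ}
  {φ : Fin q → BaseSpace p q → ℝ} {Φ : LocalOneParamGroup M}

theorem one_add_length_le {ι : Type*} {L : List ι} {n : ℕ} (hL : L.length ≤ n) :
    1 + L.length ≤ n + 1 := by
  omega

/-- The prolonged group acts on the points below `w` along a curve whose derivative at `ε = 0` is
given by the prolongation formula evaluated at `w`. -/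
theorem exists_curve_prolongedMapsTo (hM : IsOpen M) (hξ : ∀ i, ContDiffOn ℝ ∞ (ξ i) M)
    (hφ : ∀ α, ContDiffOn ℝ ∞ (φ α) M) (hΦ : Φ.IsGeneratedBy (vectorField ξ φ)) (n : ℕ)
    {w : JetSpace p q (n + 1)} (hw : w ∈ JetSpace.jetsOver M (n + 1)) :
    ∃ c : ℝ → JetSpace p q n,
      (∀ᶠ ε in 𝓝 (0 : ℝ), ∀ z', ProlongedMapsTo n (Φ.act ε) (Φ.domAt ε) (w.proj n.le_succ) z' ↔
        z' = c ε) ∧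
      HasDerivAt (fun ε => (c ε).1) (fun i => ξ i w.base) 0 ∧
      ∀ (α : Fin q) (L : List (Fin p)) (hL : L.length ≤ n),
        HasDerivAt (fun ε => (c ε).2 α ⟨(L : Multiset (Fin p)), hL⟩)
          (prolongationCoeff ξ φ α L (w.proj (one_add_length_le hL))) 0 := by
  -- The action on `n`-jets sees only the `n`-jet of `f`, but the formula involves order `n + 1`, so
  -- `f` realizes all of `w`.
  obtain ⟨f, hf, hfw⟩ := exists_contDiff_jetAt_eq w
  generalize w.1 = x₀ at hfw
  subst hfw
  rw [JetSpace.jetsOver, Set.mem_ofPred_eq, jetAt_base] at hw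
  obtain ⟨T⟩ := TransformedFamily.nonempty hM Φ hΦ hf hw
  refine ⟨fun ε => jetAt n (fun y => T.F (ε, y)) (Φ.act ε (x₀, f x₀)).1, ?_, ?_, ?_⟩
  · have hev : ∀ᶠ ε in 𝓝 (0 : ℝ), (ε, x₀) ∈ T.chart.source :=
      (Continuous.prodMk_left x₀).continuousAt.eventually
        (T.chart.open_source.mem_nhds T.mem_source)
    filter_upwards [hev] with ε hε z'
    exact ⟨T.eq_of_prolongedMapsTo hf hε, fun h => h ▸ T.prolongedMapsTo hf n hε⟩
  · rw [jetAt_base]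
    exact (hΦ _ hw).fst
  · exact fun α L hL => T.hasDerivAt_jetAt hM hξ hφ hΦ hf n α L hL

/-! ### Existence, uniqueness and smoothness of the prolonged field. -/

/-- The point of the `(n+1)`-st jet space above `z` whose coordinates of order `n + 1` vanish. -/
noncomputable def JetSpace.lift {n : ℕ} (z : JetSpace p q n) : JetSpace p q (n + 1) :=
  (z.1, fun α J => if h : J.1.card ≤ n then z.2 α ⟨J.1, h⟩ else 0)

theorem JetSpace.proj_lift {n : ℕ} (z : JetSpace p q n) : z.lift.proj n.le_succ = z := by
  refine Prod.ext rfl ?_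
  funext α J
  simp [JetSpace.lift, JetSpace.proj, J.2]

theorem JetSpace.base_lift {n : ℕ} (z : JetSpace p q n) : z.lift.base = z.base := by
  refine Prod.ext rfl ?_
  funext α
  simp [JetSpace.lift, JetSpace.base]

theorem JetSpace.contDiff_lift {n : ℕ} :
    ContDiff ℝ ∞ (JetSpace.lift : JetSpace p q n → JetSpace p q (n + 1)) := by
  refine contDiff_fst.prodMk (contDiff_pi.2 fun α => contDiff_pi.2 fun J => ?_)
  by_cases h : J.1.card ≤ n
  · simp only [h, dif_pos]
    fun_prop
  · simp only [h, dif_neg, not_false_eq_true]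
    fun_prop

/-- The vector field given by the prolongation formula. -/
noncomputable def prolongedField (ξ : Fin p → BaseSpace p q → ℝ) (φ : Fin q → BaseSpace p q → ℝ)
    (n : ℕ) (z : JetSpace p q n) : JetSpace p q n :=
  (fun i => ξ i z.base, fun α J => prolongationCoeff ξ φ α J.1.toList
    (z.lift.proj (one_add_length_le ((Multiset.length_toList J.1).trans_le J.2))))

theorem prolongedField_contDiffOn (hM : IsOpen M) (hξ : ∀ i, ContDiffOn ℝ ∞ (ξ i) M)
    (hφ : ∀ α, ContDiffOn ℝ ∞ (φ α) M) (n : ℕ) :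
    ContDiffOn ℝ ∞ (prolongedField ξ φ n) (JetSpace.jetsOver M n) := by
  refine ContDiffOn.prodMk (contDiffOn_pi.2 fun i => ?_)
    (contDiffOn_pi.2 fun α => contDiffOn_pi.2 fun J => ?_)
  · exact (hξ i).comp contDiff_base.contDiffOn fun z hz => hz
  · refine (prolongationCoeff_contDiffOn hM hξ hφ α J.1.toList).comp
      ((contDiff_proj _).comp JetSpace.contDiff_lift).contDiffOn fun z hz => ?_
    have : z.lift.base ∈ M := by rwa [JetSpace.base_lift]
    exact this

theorem isProlongation_prolongedField (hM : IsOpen M) (hξ : ∀ i, ContDiffOn ℝ ∞ (ξ i) M)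
    (hφ : ∀ α, ContDiffOn ℝ ∞ (φ α) M) (hΦ : Φ.IsGeneratedBy (vectorField ξ φ)) (n : ℕ) :
    IsProlongation Φ n (prolongedField ξ φ n) := by
  intro z hz
  have hw : z.lift ∈ JetSpace.jetsOver M (n + 1) := by
    rwa [JetSpace.jetsOver, Set.mem_ofPred_eq, JetSpace.base_lift]
  obtain ⟨c₀, hc₀, h1, h2⟩ := exists_curve_prolongedMapsTo hM hξ hφ hΦ n hw
  rw [JetSpace.proj_lift] at hc₀
  refine ⟨hc₀.mono fun ε h => ⟨c₀ ε, (h _).2 rfl, fun z' hz' => (h z').1 hz'⟩, fun c hc => ?_⟩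
  have hcc : c =ᶠ[𝓝 0] c₀ := by
    filter_upwards [hc₀, hc] with ε h h' using (h _).1 h'
  refine HasDerivAt.congr_of_eventuallyEq ?_ hcc
  refine HasDerivAt.prodMk ?_ (hasDerivAt_pi.2 fun α => hasDerivAt_pi.2 fun J => ?_)
  · rwa [JetSpace.base_lift] at h1
  · have := h2 α J.1.toList (by rw [Multiset.length_toList]; exact J.2)
    simpa only [Multiset.coe_toList] using this

/-- Uniqueness of derivatives, applied to the curve built from `w`. The left side sees only the
projection of `w` and the multiset of `L`, so the right side cannot depend on the top-order
coordinates or on the listing. -/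
theorem IsProlongation.coeff_eq (hM : IsOpen M) (hξ : ∀ i, ContDiffOn ℝ ∞ (ξ i) M)
    (hφ : ∀ α, ContDiffOn ℝ ∞ (φ α) M) (hΦ : Φ.IsGeneratedBy (vectorField ξ φ)) {n : ℕ}
    {V : JetSpace p q n → JetSpace p q n} (hV : IsProlongation Φ n V)
    {w : JetSpace p q (n + 1)} (hw : w ∈ JetSpace.jetsOver M (n + 1)) :
    (V (w.proj n.le_succ)).1 = (fun i => ξ i w.base) ∧
    ∀ (α : Fin q) (L : List (Fin p)) (hL : L.length ≤ n),
      (V (w.proj n.le_succ)).2 α ⟨(L : Multiset (Fin p)), hL⟩ =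
        prolongationCoeff ξ φ α L (w.proj (one_add_length_le hL)) := by
  obtain ⟨c, hc, h1, h2⟩ := exists_curve_prolongedMapsTo hM hξ hφ hΦ n hw
  have hd := (hV (w.proj n.le_succ) hw).2 c (hc.mono fun ε h => (h _).2 rfl)
  have hfst : HasDerivAt (fun ε => (c ε).1) (V (w.proj n.le_succ)).1 0 := hd.fst
  have hsnd : HasDerivAt (fun ε => (c ε).2) (V (w.proj n.le_succ)).2 0 := hd.snd
  exact ⟨hfst.unique h1, fun α L hL =>
    (hasDerivAt_pi.1 (hasDerivAt_pi.1 hsnd α) _).unique (h2 α L hL)⟩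

theorem IsProlongation.eqOn_prolongedField (hM : IsOpen M) (hξ : ∀ i, ContDiffOn ℝ ∞ (ξ i) M)
    (hφ : ∀ α, ContDiffOn ℝ ∞ (φ α) M) (hΦ : Φ.IsGeneratedBy (vectorField ξ φ)) {n : ℕ}
    {V : JetSpace p q n → JetSpace p q n} (hV : IsProlongation Φ n V) :
    Set.EqOn V (prolongedField ξ φ n) (JetSpace.jetsOver M n) := by
  intro z hz
  have hw : z.lift ∈ JetSpace.jetsOver M (n + 1) := by
    rwa [JetSpace.jetsOver, Set.mem_ofPred_eq, JetSpace.base_lift]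
  obtain ⟨h1, h2⟩ := hV.coeff_eq hM hξ hφ hΦ hw
  rw [JetSpace.proj_lift, JetSpace.base_lift] at h1
  refine Prod.ext h1 ?_
  funext α J
  have := h2 α J.1.toList (by rw [Multiset.length_toList]; exact J.2)
  rw [JetSpace.proj_lift] at this
  simp only [Multiset.coe_toList] at this
  exact this

theorem prolongationCoeff_nil (ξ : Fin p → BaseSpace p q → ℝ) (φ : Fin q → BaseSpace p q → ℝ)
    (α : Fin q) (w : JetSpace p q 1) : prolongationCoeff ξ φ α [] w = φ α w.base :=
  sub_add_cancel (φ α w.base) _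

end Prolongation

theorem mainTheorem8 {p q : ℕ} (M : Set (BaseSpace p q)) (hM : IsOpen M)
    (ξ : Fin p → BaseSpace p q → ℝ) (φ : Fin q → BaseSpace p q → ℝ)
    (hξ : ∀ i, ContDiffOn ℝ ∞ (ξ i) M) (hφ : ∀ α, ContDiffOn ℝ ∞ (φ α) M)
    (Φ : LocalOneParamGroup M) (hΦ : Φ.IsGeneratedBy (vectorField ξ φ)) (n : ℕ) :
    (∃ V : JetSpace p q n → JetSpace p q n, IsProlongation Φ n V) ∧
    ∀ V : JetSpace p q n → JetSpace p q n, IsProlongation Φ n V →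
      ContDiffOn ℝ ∞ V (JetSpace.jetsOver M n) ∧
      (∀ z ∈ JetSpace.jetsOver M n,
        (∀ i, (V z).1 i = ξ i z.base) ∧
        (∀ α, (V z).2 α ⟨0, Nat.zero_le n⟩ = φ α z.base)) ∧
      -- the coefficient of `∂/∂u^α_J`; as the formula a priori lives on a jet space of order up to
      -- `n + 1`, it is evaluated at an arbitrary point `w` of `M^(n+1)` above the point of `M^(n)`
      ∀ w ∈ JetSpace.jetsOver M (n + 1), ∀ (α : Fin q) (L : List (Fin p)) (hL : L.length ≤ n),
        (V (w.proj n.le_succ)).2 α ⟨(L : Multiset (Fin p)), hL⟩ =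
          prolongationCoeff ξ φ α L (w.proj (show 1 + L.length ≤ n + 1 by omega)) := by
  refine ⟨⟨_, isProlongation_prolongedField hM hξ hφ hΦ n⟩, fun V hV => ⟨?_, fun z hz => ?_, ?_⟩⟩
  · exact (prolongedField_contDiffOn hM hξ hφ n).congr (hV.eqOn_prolongedField hM hξ hφ hΦ)
  · have hw : z.lift ∈ JetSpace.jetsOver M (n + 1) := by
      rwa [JetSpace.jetsOver, Set.mem_ofPred_eq, JetSpace.base_lift]
    obtain ⟨h1, h2⟩ := hV.coeff_eq hM hξ hφ hΦ hw
    rw [JetSpace.proj_lift, JetSpace.base_lift] at h1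
    refine ⟨fun i => congrFun h1 i, fun α => ?_⟩
    -- The coordinate `u^α` is the case of empty `J`, where the two sums over `ξ^i u^α_i` cancel.
    have h3 := h2 α [] (Nat.zero_le n)
    rw [JetSpace.proj_lift] at h3
    refine (h3.trans (prolongationCoeff_nil ξ φ α _)).trans ?_
    exact congrArg (φ α) (JetSpace.base_lift z)
  · exact fun w hw => (hV.coeff_eq hM hξ hφ hΦ hw).2
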